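/- Let $n\ge 1$ and $m=2n+1$, and let $d_1<\dots<d_m$ be positive integers with $\gcd(d_1,\dots,d_m)=1$, none of which is a combination of the others with nonnegative integer coefficients. Let $S=\{\sum_i x_id_i : x_i\in\mathbb Z_{\ge 0}\}$, let $c$ be the least element of $S$ with $c+\mathbb Z_{\ge0}\subseteq S$, let $F=c-1$ be the Frobenius number of $S$, and put $\Sigma=d_1+\dots+d_m$. Let $\Delta_{\mathcal H}$ be the set of positive integers $h\notin S$ with $F-h\notin S$, let $\gamma=\#\Delta_{\mathcal H}$, and let $S'$ be the set of integers $f\notin S$ with $f+s\in S$ for all $s\in S\setminus\{0\}$. Assume that $S$ is almost symmetric, i.e. $S'\setminus\{F\}=\Delta_{\mathcal H}$. Let $k$ be a field of characteristic $0$, and consider the minimal graded free resolution of the semigroup ring $k[z^{d_1},\dots,z^{d_m}]$ over $k[X_1,\dots,X_m]$, where $\deg X_i=d_i$ and $X_i$ acts as $z^{d_i}$. Let $\beta_i$ be the rank of its $i$-th free module $F_i$, and let $C_{1,i},\dots,C_{\beta_i,i}$ be the degrees of the elements of a homogeneous basis of $F_i$. Put $\overline C_{j,i}=F+\Sigma-C_{j,i}$.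 All of the following are multisets; a union adds multiplicities and an intersection takes their minimum. For $1\le i\le m-1$ let $\mathfrak L_i$ be the multiset of all numbers $d_{j_1}+\dots+d_{j_i}+h$ with $j_1<\dots<j_i$ and $h\in\Delta_{\mathcal H}$. Let $\mathfrak L_o$ be the union of the $\mathfrak L_i$ with $i$ odd, $\mathfrak L_e$ the union of those with $i$ even, and $\ell=\#(\mathfrak L_e\cap\mathfrak L_o)$. Let $\mathfrak X_1$ consist of all $C_{j,i}$ with $i$ odd and all $\overline C_{j,i}$ with $i$ even, and let $\mathfrak X_2$ consist of all $C_{j,i}$ with $i$ even and all $\overline C_{j,i}$ with $i$ odd, where $1\le i\le 2n-1$ and $1\le j\le\beta_i$. Let $\wp=\#(\mathfrak X_1\cap\mathfrak X_2)$ and $\delta=\wp-\ell$. Then $$\beta_1+\beta_3+\dots+\beta_{2n-1}=\gamma\cdot 2^{2n-1}+\tfrac12\,\delta+1,$$ $$\beta_2+\beta_4+\dots+\beta_{2n-2}=\gamma\,(2^{2n-1}-1)+\tfrac12\,\delta-1,$$ where the left-hand side of the second equation is $0$ if $n=1$. -/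

import Mathlib

open MvPolynomial

namespace NumSemigroup

/-! ### Numerical semigroups -/

/-- `d₁ < … < d_m` are positive integers with `gcd (d₁, …, d_m) = 1`, none of which is a
combination of the others with nonnegative integer coefficients: they are the minimal generators
of a numerical semigroup of embedding dimension `m`. -/
structure IsMinimalGenerators {m : ℕ} (d : Fin m → ℕ) : Prop where
  strictMono : StrictMono d
  pos : ∀ i, 0 < d i
  gcd_eq_one : Finset.univ.gcd d = 1
  minimal : ∀ i, d i ∉ AddSubmonoid.closure (d '' {j | j ≠ i})

/-- The semigroup `S` generated by `d₁, …, d_m`. -/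
def semigroup {m : ℕ} (d : Fin m → ℕ) : AddSubmonoid ℕ :=
  AddSubmonoid.closure (Set.range d)

/-- The semigroup `S` as a set of integers. -/
def semigroupInt {m : ℕ} (d : Fin m → ℕ) : Set ℤ :=
  {x | ∃ s ∈ semigroup d, (s : ℤ) = x}

/-- The conductor: the least `c ∈ S` with `c + x ∈ S` for all natural numbers `x`. -/
noncomputable def conductor {m : ℕ} (d : Fin m → ℕ) : ℕ :=
  sInf {c | c ∈ semigroup d ∧ ∀ x : ℕ, c + x ∈ semigroup d}

/-- The Frobenius number `F = c - 1`, an integer. -/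
noncomputable def frobenius {m : ℕ} (d : Fin m → ℕ) : ℤ :=
  (conductor d : ℤ) - 1

/-- The sum `Σ_m` of the generators. -/
def genSum {m : ℕ} (d : Fin m → ℕ) : ℤ :=
  ∑ j, (d j : ℤ)

open Classical in
/-- The set of gaps of `S`, i.e. the positive integers outside `S`; all of them are at most the
Frobenius number. -/
noncomputable def gaps {m : ℕ} (d : Fin m → ℕ) : Finset ℤ :=
  {g ∈ Finset.Icc 1 (frobenius d) | g ∉ semigroupInt d}

open Classical in
/-- The set `Δ_H` of those gaps `h` for which `F - h` is not in `S` either. -/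
noncomputable def gapsH {m : ℕ} (d : Fin m → ℕ) : Finset ℤ :=
  {h ∈ gaps d | frobenius d - h ∉ semigroupInt d}

/-- The number `γ = #Δ_H`. -/
noncomputable def gam {m : ℕ} (d : Fin m → ℕ) : ℕ :=
  (gapsH d).card

/-- The set `S'` of integers `f ∉ S` with `f + s ∈ S` for all nonzero `s ∈ S`. -/
def pseudoFrobenius {m : ℕ} (d : Fin m → ℕ) : Set ℤ :=
  {f | f ∉ semigroupInt d ∧ ∀ s ∈ semigroupInt d, s ≠ 0 → f + s ∈ semigroupInt d}

/-- `S` is almost symmetric: `S' \ {F} = Δ_H`. -/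
def IsAlmostSymmetric {m : ℕ} (d : Fin m → ℕ) : Prop :=
  pseudoFrobenius d \ {frobenius d} = (gapsH d : Set ℤ)

/-! ### The minimal graded free resolution of the semigroup ring -/

/-- The homomorphism `k[X₁, …, X_m] → k[z]`, `X_i ↦ z ^ d_i`. -/
noncomputable def paramMap (k : Type*) [Field k] {m : ℕ} (d : Fin m → ℕ) :
    MvPolynomial (Fin m) k →ₐ[k] Polynomial k :=
  aeval fun i => (Polynomial.X : Polynomial k) ^ d i

/-- The semigroup ring `k[z ^ d₁, …, z ^ d_m] ⊆ k[z]`. -/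
noncomputable def semigroupRing (k : Type*) [Field k] {m : ℕ} (d : Fin m → ℕ) :
    Subalgebra k (Polynomial k) :=
  Algebra.adjoin k (Set.range fun i => (Polynomial.X : Polynomial k) ^ d i)

/-- A minimal graded free resolution `⋯ → F₂ → F₁ → F₀ → k[S] → 0` of the semigroup ring `k[S]`
over `R = k[X₁, …, X_m]`, where `deg X_i = d_i` and `R` acts on `k[S] ⊆ k[z]` through
`X_i ↦ z ^ d_i`. Here `F_i` is the free module of rank `rank i` whose `j`-th basis element is
homogeneous of degree `deg i j`. The differential `F_{i+1} → F_i` is the matrix `diff i`, and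
the augmentation `F₀ → k[S]` sends the `j`-th basis element to `aug j`. -/
structure MinimalGradedFreeResolution (k : Type*) [Field k] {m : ℕ} (d : Fin m → ℕ) where
  rank : ℕ → ℕ
  deg : (i : ℕ) → Fin (rank i) → ℕ
  aug : Fin (rank 0) → Polynomial k
  diff : (i : ℕ) → Matrix (Fin (rank i)) (Fin (rank (i + 1))) (MvPolynomial (Fin m) k)
  /-- The augmentation has degree `0`. -/
  aug_homogeneous : ∀ j, ∃ c : k, aug j = Polynomial.monomial (deg 0 j) c
  /-- The differentials have degree `0`: the entry in position `(a, b)` of the `i`-th matrix is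
  homogeneous of degree `deg (i + 1) b - deg i a` (so it is zero if this is negative). -/
  diff_homogeneous : ∀ i a b u, coeff u (diff i a b) ≠ 0 →
    Finsupp.weight d u + deg i a = deg (i + 1) b
  /-- The image of the augmentation is `k[S]`. -/
  range_aug : (Set.range fun v : Fin (rank 0) → MvPolynomial (Fin m) k =>
    ∑ j, paramMap k d (v j) * aug j) = (semigroupRing k d : Set (Polynomial k))
  /-- Exactness at `F₀`. -/
  exact_zero : Function.Exact (diff 0).mulVec
    (fun v : Fin (rank 0) → MvPolynomial (Fin m) k => ∑ j, paramMap k d (v j) * aug j)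
  /-- Exactness at `F_{i+1}`. -/
  exact_succ : ∀ i, Function.Exact (diff (i + 1)).mulVec (diff i).mulVec
  /-- Minimality: the image of `F_{i+1}` lies in `(X₁, …, X_m) F_i`. -/
  minimal : ∀ i a b, constantCoeff (diff i a b) = 0

namespace MinimalGradedFreeResolution

variable {k : Type*} [Field k] {m : ℕ} {d : Fin m → ℕ}

/-- The Betti number `β_i`. -/
def betti (P : MinimalGradedFreeResolution k d) (i : ℕ) : ℕ :=
  P.rank i

/-- The multiset of the degrees `C_{j,i}`, `1 ≤ j ≤ β_i`, of the syzygies of the `i`-th kind. -/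
def syzygyDegrees (P : MinimalGradedFreeResolution k d) (i : ℕ) : Multiset ℤ :=
  Finset.univ.val.map fun j => (P.deg i j : ℤ)

/-- The multiset of the numbers `F + Σ_m - C_{j,i}`, `1 ≤ j ≤ β_i`. -/
noncomputable def dualDegrees (P : MinimalGradedFreeResolution k d) (i : ℕ) : Multiset ℤ :=
  (P.syzygyDegrees i).map fun c => frobenius d + genSum d - c

end MinimalGradedFreeResolution

/-! ### Multisets of degrees. The sum `+` of multisets adds multiplicities, and the intersection
`∩` takes their minimum. -/

/-- The multiset `D_i` of the sums of `i` generators with distinct indices. -/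
def genSums {m : ℕ} (d : Fin m → ℕ) (i : ℕ) : Multiset ℤ :=
  (Finset.univ.powersetCard i).val.map fun I : Finset (Fin m) => ∑ j ∈ I, (d j : ℤ)

/-- The multiset `L_i` of the sums `x + h` with `x ∈ D_i` and `h ∈ Δ_H`. -/
noncomputable def genGapSums {m : ℕ} (d : Fin m → ℕ) (i : ℕ) : Multiset ℤ :=
  (genSums d i ×ˢ (gapsH d).val).map fun p => p.1 + p.2

/-- The join `L_o` of the `L_i` over the odd `i` with `1 ≤ i ≤ m - 1`. -/
noncomputable def genGapSumsOdd {m : ℕ} (d : Fin m → ℕ) : Multiset ℤ :=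
  ∑ i ∈ Finset.Icc 1 (m - 1) with Odd i, genGapSums d i

/-- The join `L_e` of the `L_i` over the even `i` with `1 ≤ i ≤ m - 1`. -/
noncomputable def genGapSumsEven {m : ℕ} (d : Fin m → ℕ) : Multiset ℤ :=
  ∑ i ∈ Finset.Icc 1 (m - 1) with Even i, genGapSums d i

/-- The cardinality `ℓ` of the intersection of `L_e` and `L_o`. -/
noncomputable def ell {m : ℕ} (d : Fin m → ℕ) : ℕ :=
  (genGapSumsEven d ∩ genGapSumsOdd d).card

namespace MinimalGradedFreeResolution

variable {k : Type*} [Field k] {n : ℕ} {d : Fin (2 * n + 1) → ℕ}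

/-- For `m = 2n + 1`: the join of the `C_{j,i}` with odd `i ≤ 2n - 1` and of the
`F + Σ_m - C_{j,i}` with even `i`, `2 ≤ i ≤ 2n - 2`. -/
noncomputable def degreesOne (P : MinimalGradedFreeResolution k d) : Multiset ℤ :=
  (∑ q ∈ Finset.Icc 1 n, P.syzygyDegrees (2 * q - 1)) +
    ∑ q ∈ Finset.Icc 1 (n - 1), P.dualDegrees (2 * q)

/-- For `m = 2n + 1`: the join of the `C_{j,i}` with even `i`, `2 ≤ i ≤ 2n - 2`, and of the
`F + Σ_m - C_{j,i}` with odd `i ≤ 2n - 1`. -/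
noncomputable def degreesTwo (P : MinimalGradedFreeResolution k d) : Multiset ℤ :=
  (∑ q ∈ Finset.Icc 1 (n - 1), P.syzygyDegrees (2 * q)) +
    ∑ q ∈ Finset.Icc 1 n, P.dualDegrees (2 * q - 1)

/-- The cardinality `℘` of the intersection of the two multisets of degrees. -/
noncomputable def wp (P : MinimalGradedFreeResolution k d) : ℕ :=
  (P.degreesOne ∩ P.degreesTwo).card

/-- The integer `δ = ℘ - ℓ`. -/
noncomputable def delta (P : MinimalGradedFreeResolution k d) : ℤ :=
  (P.wp : ℤ) - (ell d : ℤ)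

end MinimalGradedFreeResolution

end NumSemigroup

/-! Write `R = k[X₁, …, X_m]`, `Σ = d₁ + ⋯ + d_m`, `D = ∏ (1 - T^{d_i})`, `H = ∑ T^h` over `h ∈
Δ_H`, and let `Q` be the alternating sum of the `T^{C_{j,i}}`, i.e. the numerator of the Hilbert
series of `k[S]`. Two facts determine the sums of Betti numbers.

Functional equation. If `G = ∑ T^g` over the gaps, then `(1 - T) Q = (1 - (1 - T) G) D`. The gaps
`g` and their mirror images `F - g` cover `[0, F]` and overlap exactly in `Δ_H`; for odd `m`,
moreover, `T^Σ D(T⁻¹) = -D`. Hence `T^{F+Σ} Q(T⁻¹) = Q + D H` (`functional_equation`).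

Last module. `F_{m-1} ⊗ k = Tor_{m-1}(k[S], k)` is, up to a shift by `d₂ + ⋯ + d_m`, the socle of
`k[S]/(z^{d₁})`, which lives in the degrees `f + d₁` with `f ∈ S'`. So the degrees of `F_{m-1}` are
the `f + Σ` (`syzygyDegrees_last`), and almost symmetry says that `f` runs over `F` and `Δ_H`. The
socle is reached by iterated connecting homomorphisms, killing one variable at a time; the same
induction gives `F_i = 0` for `i ≥ m`.

Inserting the degrees of `F₀` and `F_{2n}` into the functional equation cancels all extreme terms
and leaves an equality of multisets, `𝔛₁ + 𝔏_o = 𝔛₂ + 𝔏_e` (`degreesOne_add_genGapSumsOdd`). Thus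
`𝔛₁ - 𝔛₂ = 𝔏_e - 𝔏_o` as truncated differences. Since `#𝔛₁ = #𝔛₂`, also `#𝔏_o = #𝔏_e = γ (2^{2n} -
1)`, and counting gives `o + e = γ (2^{2n} - 1) + δ` for the odd and even sums `o`, `e`. Finally
`Q(1) = 0` gives `o - e = γ + 2`. -/

namespace NumSemigroup

/-! ### Homogeneous components of vectors of polynomials -/

section Components

variable {k : Type*} [Field k] {m : ℕ}

/-- The component of weighted degree `c - α`, as a linear map; it is zero if `c < α`. -/
noncomputable def shiftedComponent (d : Fin m → ℕ) (α c : ℕ) :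
    MvPolynomial (Fin m) k →ₗ[k] MvPolynomial (Fin m) k :=
  if α ≤ c then weightedHomogeneousComponent d (c - α) else 0

lemma coeff_shiftedComponent (d : Fin m → ℕ) (α c : ℕ) (p : MvPolynomial (Fin m) k)
    (u : Fin m →₀ ℕ) :
    coeff u (shiftedComponent d α c p) = if Finsupp.weight d u + α = c then coeff u p else 0 := by
  classical
  unfold shiftedComponent
  by_cases h : α ≤ c
  · rw [if_pos h, coeff_weightedHomogeneousComponent]
    congr 1
    exact propext (by omega)
  · rw [if_neg h, if_neg (by omega)]
    simp

/-- The hypothesis makes `q` homogeneous of degree `(β - α) + (c - c')`, written without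
subtraction. It serves both for matrix entries (`c = c'`) and for multiplication by a variable (`α =
β`). -/
lemma shiftedComponent_mul (d : Fin m → ℕ) {α β c c' : ℕ} {q : MvPolynomial (Fin m) k}
    (hq : ∀ u, coeff u q ≠ 0 → Finsupp.weight d u + α + c' = β + c) (p : MvPolynomial (Fin m) k) :
    shiftedComponent d α c (q * p) = q * shiftedComponent d β c' p := by
  classical
  ext u
  have key : ∀ x ∈ Finset.HasAntidiagonal.antidiagonal u, coeff x.1 q * coeff x.2 (shiftedComponent d β c' p) =
      if Finsupp.weight d u + α = c then coeff x.1 q * coeff x.2 p else 0 := by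
    intro x hx
    rw [Finset.HasAntidiagonal.mem_antidiagonal] at hx
    by_cases h0 : coeff x.1 q = 0
    · simp [h0]
    have h1 := hq _ h0
    rw [coeff_shiftedComponent, ← hx, map_add, mul_ite, mul_zero]
    congr 1
    exact propext (by omega)
  rw [coeff_shiftedComponent, coeff_mul, coeff_mul, Finset.sum_congr rfl key]
  split_ifs <;> simp

/-- The component of degree `c` of a vector in a free module whose basis elements have the
degrees `e`. -/
noncomputable def vecComponent {r : ℕ} (d : Fin m → ℕ) (e : Fin r → ℕ) (c : ℕ) :
    (Fin r → MvPolynomial (Fin m) k) →ₗ[k] (Fin r → MvPolynomial (Fin m) k) :=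
  LinearMap.pi fun a => shiftedComponent d (e a) c ∘ₗ LinearMap.proj a

lemma coeff_vecComponent {r : ℕ} (d : Fin m → ℕ) (e : Fin r → ℕ) (c : ℕ)
    (v : Fin r → MvPolynomial (Fin m) k) (a : Fin r) (u : Fin m →₀ ℕ) :
    coeff u (vecComponent d e c v a) =
      if Finsupp.weight d u + e a = c then coeff u (v a) else 0 :=
  coeff_shiftedComponent _ _ _ _ _

lemma vecComponent_mulVec {r s : ℕ} (d : Fin m → ℕ) {e : Fin r → ℕ} {f : Fin s → ℕ}
    {M : Matrix (Fin r) (Fin s) (MvPolynomial (Fin m) k)}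
    (hM : ∀ a b u, coeff u (M a b) ≠ 0 → Finsupp.weight d u + e a = f b) (c : ℕ)
    (v : Fin s → MvPolynomial (Fin m) k) :
    vecComponent d e c (M.mulVec v) = M.mulVec (vecComponent d f c v) := by
  ext1 a
  simp only [vecComponent, LinearMap.pi_apply, LinearMap.comp_apply, LinearMap.proj_apply,
    Matrix.mulVec, dotProduct, map_sum]
  exact Finset.sum_congr rfl fun b _ => shiftedComponent_mul d (fun u hu => by
    rw [hM a b u hu]) _

lemma vecComponent_X_smul {r : ℕ} (d : Fin m → ℕ) (e : Fin r → ℕ) (c : ℕ) (j : Fin m)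
    (v : Fin r → MvPolynomial (Fin m) k) :
    vecComponent d e (c + d j) ((X j : MvPolynomial (Fin m) k) • v) =
      (X j : MvPolynomial (Fin m) k) • vecComponent d e c v := by
  classical
  ext1 a
  refine shiftedComponent_mul d (fun u hu => ?_) _
  rw [coeff_X] at hu
  have : Finsupp.single j 1 = u := by by_contra h; simp [h] at hu
  subst this
  simp [Finsupp.weight_apply]
  ring

/-! ### Vectors with entries in the ideal generated by the first `r` variables -/

/-- The `r`-th variable, counted from `0`. -/
noncomputable def var (k : Type*) [Field k] (m r : ℕ) : MvPolynomial (Fin m) k :=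
  if h : r < m then X ⟨r, h⟩ else 0

/-- The vectors with entries in the ideal generated by the first `r` variables. -/
noncomputable def initialVars (k : Type*) [Field k] (m r n : ℕ) :
    Submodule (MvPolynomial (Fin m) k) (Fin n → MvPolynomial (Fin m) k) :=
  Submodule.pi Set.univ fun _ => Ideal.span (X '' {j : Fin m | j.val < r})

lemma mem_initialVars {r n : ℕ} {v : Fin n → MvPolynomial (Fin m) k} :
    v ∈ initialVars k m r n ↔
      ∀ a u, coeff u (v a) ≠ 0 → ∃ j : Fin m, j.val < r ∧ u j ≠ 0 := by
  simp [initialVars, Submodule.mem_pi, mem_ideal_span_X_image]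

lemma initialVars_mono {r s n : ℕ} (h : r ≤ s) : initialVars k m r n ≤ initialVars k m s n := by
  intro v hv
  rw [mem_initialVars] at hv ⊢
  intro a u hu
  obtain ⟨j, hj, hj'⟩ := hv a u hu
  exact ⟨j, by omega, hj'⟩

lemma initialVars_zero {n : ℕ} : initialVars k m 0 n = ⊥ := by
  ext v
  simp [initialVars, funext_iff]

lemma mem_initialVars_top {n : ℕ} {v : Fin n → MvPolynomial (Fin m) k} :
    v ∈ initialVars k m m n ↔ ∀ a, constantCoeff (v a) = 0 := by
  rw [mem_initialVars]
  refine forall_congr' fun a => ⟨fun h => ?_, fun h u hu => ?_⟩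
  · by_contra h0
    obtain ⟨j, -, hj⟩ := h 0 (by simpa [constantCoeff_eq] using h0)
    simp at hj
  · by_contra! h1
    have : u = 0 := by ext j; simpa using h1 j j.isLt
    subst this
    exact hu (by simpa [constantCoeff_eq] using h)

lemma mulVec_mem_initialVars {r n s : ℕ} (M : Matrix (Fin n) (Fin s) (MvPolynomial (Fin m) k))
    {v : Fin s → MvPolynomial (Fin m) k} (hv : v ∈ initialVars k m r s) :
    M.mulVec v ∈ initialVars k m r n := by
  simp only [initialVars, Submodule.mem_pi, Set.mem_univ, forall_true_left] at hv ⊢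
  intro a
  simp only [Matrix.mulVec, dotProduct]
  exact Ideal.sum_mem _ fun b _ => Ideal.mul_mem_left _ (M a b) (hv b)

lemma vecComponent_mem_initialVars {r n : ℕ} (d : Fin m → ℕ) (e : Fin n → ℕ) (c : ℕ)
    {v : Fin n → MvPolynomial (Fin m) k} (hv : v ∈ initialVars k m r n) :
    vecComponent d e c v ∈ initialVars k m r n := by
  rw [mem_initialVars] at hv ⊢
  intro a u hu
  rw [coeff_vecComponent] at hu
  exact hv a u fun h => hu (by simp [h])

/-- The variables form a regular sequence on a free module; this is the cancellation used in all the
diagram chases below. -/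
lemma mem_of_var_smul_mem {r n : ℕ} (hr : r < m) {v : Fin n → MvPolynomial (Fin m) k}
    (hv : var k m r • v ∈ initialVars k m r n) : v ∈ initialVars k m r n := by
  rw [mem_initialVars] at hv ⊢
  intro a u hu
  obtain ⟨j, hj, hj'⟩ := hv a (Finsupp.single ⟨r, hr⟩ 1 + u) (by
    rwa [var, dif_pos hr, Pi.smul_apply, smul_eq_mul, coeff_X_mul])
  refine ⟨j, hj, ?_⟩
  have : (⟨r, hr⟩ : Fin m) ≠ j := by rintro rfl; simp at hj
  simpa [Finsupp.single_apply, this] using hj'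

lemma mem_initialVars_succ {r n : ℕ} {v : Fin n → MvPolynomial (Fin m) k} (hr : r < m) :
    v ∈ initialVars k m (r + 1) n ↔ ∃ w, v - var k m r • w ∈ initialVars k m r n := by
  have hset : {j : Fin m | j.val < r + 1} = insert ⟨r, hr⟩ {j : Fin m | j.val < r} := by
    ext j
    simp [Fin.ext_iff]
    omega
  simp only [initialVars, Submodule.mem_pi, Set.mem_univ, forall_true_left, hset,
    Set.image_insert_eq, Ideal.span_insert, Submodule.mem_sup, Ideal.mem_span_singleton']
  constructor
  · intro h
    choose y hy z hz hyz using h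
    choose w hw using hy
    refine ⟨w, fun a => ?_⟩
    convert hz a using 1
    rw [Pi.sub_apply, Pi.smul_apply, ← hyz a, ← hw a, var, dif_pos hr, smul_eq_mul]
    ring
  · rintro ⟨w, hw⟩ a
    refine ⟨_, ⟨w a, rfl⟩, _, hw a, ?_⟩
    rw [Pi.sub_apply, Pi.smul_apply, var, dif_pos hr, smul_eq_mul]
    ring

lemma var_smul_mem_initialVars {r n : ℕ} (hr : r < m) (w : Fin n → MvPolynomial (Fin m) k) :
    var k m r • w ∈ initialVars k m (r + 1) n :=
  (mem_initialVars_succ hr).2 ⟨w, by simp⟩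

end Components
namespace MinimalGradedFreeResolution

/-! ### The Koszul homology of the resolution -/

section Koszul

variable {k : Type*} [Field k] {m : ℕ} {d : Fin m → ℕ} (P : MinimalGradedFreeResolution k d)

/-- The free module `F_i`. -/
abbrev Free (i : ℕ) : Type _ := Fin (P.rank i) → MvPolynomial (Fin m) k

/-- The differential `F_{i+1} → F_i`. -/
noncomputable def diffLin (i : ℕ) : P.Free (i + 1) →ₗ[MvPolynomial (Fin m) k] P.Free i :=
  (P.diff i).mulVecLin

/-- The augmentation `F₀ → k[z]`. -/
noncomputable def augLin : P.Free 0 →ₗ[k] Polynomial k :=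
  ∑ j, LinearMap.mulRight k (P.aug j) ∘ₗ (paramMap k d).toLinearMap ∘ₗ LinearMap.proj j

lemma augLin_apply (v : P.Free 0) : P.augLin v = ∑ j, paramMap k d (v j) * P.aug j := by
  simp [augLin]

lemma augLin_smul (p : MvPolynomial (Fin m) k) (v : P.Free 0) :
    P.augLin (p • v) = paramMap k d p * P.augLin v := by
  simp [augLin_apply, Finset.mul_sum, mul_assoc]

lemma augLin_eq_zero_iff {v : P.Free 0} : P.augLin v = 0 ↔ ∃ w, P.diffLin 0 w = v := by
  rw [augLin_apply]
  exact P.exact_zero v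

lemma diffLin_eq_zero_iff {i : ℕ} {v : P.Free (i + 1)} :
    P.diffLin i v = 0 ↔ ∃ w, P.diffLin (i + 1) w = v :=
  P.exact_succ i v

lemma diffLin_diffLin {i : ℕ} (v : P.Free (i + 2)) : P.diffLin i (P.diffLin (i + 1) v) = 0 :=
  P.diffLin_eq_zero_iff.2 ⟨v, rfl⟩

lemma augLin_diffLin (v : P.Free 1) : P.augLin (P.diffLin 0 v) = 0 :=
  P.augLin_eq_zero_iff.2 ⟨v, rfl⟩

variable {P} in
lemma diffLin_mem {r i : ℕ} {v : P.Free (i + 1)} (hv : v ∈ initialVars k m r (P.rank (i + 1))) :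
    P.diffLin i v ∈ initialVars k m r (P.rank i) :=
  mulVec_mem_initialVars _ hv

lemma diffLin_mem_top {i : ℕ} (v : P.Free (i + 1)) :
    P.diffLin i v ∈ initialVars k m m (P.rank i) := by
  rw [mem_initialVars_top]
  intro a
  simp [diffLin, Matrix.mulVec, dotProduct, P.minimal i a]

lemma vecComponent_diffLin {i : ℕ} (c : ℕ) (v : P.Free (i + 1)) :
    vecComponent d (P.deg i) c (P.diffLin i v) =
      P.diffLin i (vecComponent d (P.deg (i + 1)) c v) :=
  vecComponent_mulVec d (P.diff_homogeneous i) c v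

lemma paramMap_var {r : ℕ} (hr : r < m) : paramMap k d (var k m r) = Polynomial.X ^ d ⟨r, hr⟩ := by
  simp [paramMap, var, hr]

/-- The first variable acts on the domain `k[S]` as the nonzerodivisor `z^{d₁}`, so reduction modulo
it creates no homology in positive degrees. -/
lemma exact_mod_first_var (hm : 0 < m) {i : ℕ} {v : P.Free (i + 1)}
    (hv : P.diffLin i v ∈ initialVars k m 1 (P.rank i)) :
    ∃ w, v - P.diffLin (i + 1) w ∈ initialVars k m 1 (P.rank (i + 1)) := by
  obtain ⟨w, hw⟩ := (mem_initialVars_succ hm).1 hv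
  rw [initialVars_zero, Submodule.mem_bot, sub_eq_zero] at hw
  obtain ⟨y, hy⟩ : ∃ y, P.diffLin i y = w := by
    cases i with
    | zero =>
      rw [← P.augLin_eq_zero_iff]
      have h := P.augLin_diffLin v
      rw [hw, augLin_smul, paramMap_var hm] at h
      simpa using h
    | succ i =>
      rw [← P.diffLin_eq_zero_iff]
      have h := P.diffLin_diffLin v
      rw [hw, map_smul] at h
      have h1 := mem_of_var_smul_mem hm (v := P.diffLin i w) (by rw [h]; exact zero_mem _)
      rwa [initialVars_zero, Submodule.mem_bot] at h1
  have h0 : P.diffLin i (v - var k m 0 • y) = 0 := by rw [map_sub, map_smul, hy, hw, sub_self]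
  obtain ⟨z, hz⟩ := P.diffLin_eq_zero_iff.1 h0
  exact ⟨z, by rw [hz, sub_sub_cancel]; exact var_smul_mem_initialVars hm y⟩

/-- The reduction of the resolution modulo the first `r ≥ 1` variables is exact in homological
degrees at least `r`. -/
lemma exact_mod_vars {r : ℕ} (hr : 1 ≤ r) (hrm : r ≤ m) : ∀ {i : ℕ}, r ≤ i + 1 →
    ∀ {v : P.Free (i + 1)}, P.diffLin i v ∈ initialVars k m r (P.rank i) →
    ∃ w, v - P.diffLin (i + 1) w ∈ initialVars k m r (P.rank (i + 1)) := by
  induction r, hr using Nat.le_induction with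
  | base => exact fun _ _ hv => P.exact_mod_first_var (by omega) hv
  | succ r hr ih =>
    intro i hi v hv
    obtain ⟨w, hw⟩ := (mem_initialVars_succ (by omega)).1 hv
    obtain ⟨i, rfl⟩ : ∃ i', i = i' + 1 := ⟨i - 1, by omega⟩
    -- From `∂v ≡ x_r w` it follows that `x_r ∂w ≡ 0`, hence `∂w ≡ 0` modulo the first `r`
    -- variables. By induction `w ≡ ∂w'`, and then `v - x_r w'` is a cycle modulo the first `r`
    -- variables.
    have h1 := diffLin_mem hw
    rw [map_sub, diffLin_diffLin, zero_sub, map_smul, neg_mem_iff] at h1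
    obtain ⟨w', hw'⟩ := ih (by omega) (by omega) (mem_of_var_smul_mem (by omega) h1)
    have h2 : P.diffLin (i + 1) (v - var k m r • w') ∈ initialVars k m r (P.rank (i + 1)) := by
      have := add_mem hw (Submodule.smul_mem _ (var k m r) hw')
      rw [map_sub, map_smul]
      convert this using 1
      module
    obtain ⟨z, hz⟩ := ih (by omega) (by omega) h2
    refine ⟨z, ?_⟩
    convert add_mem (initialVars_mono (Nat.le_succ r) hz)
      (var_smul_mem_initialVars (by omega : r < m) w') using 1
    module

lemma single_notMem_initialVars {r : ℕ} (j : Fin r) :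
    (Pi.single j 1 : Fin r → MvPolynomial (Fin m) k) ∉ initialVars k m m r := by
  rw [mem_initialVars_top]
  intro h
  simpa using h j

/-- Modulo all variables the differentials vanish by minimality, but the complex is exact in degrees
at least `m`; a basis vector there would lie in `(X₁, …, X_m) F_i`. -/
lemma rank_eq_zero (hm : 1 ≤ m) {i : ℕ} (hi : m ≤ i) : P.rank i = 0 := by
  obtain ⟨i, rfl⟩ : ∃ i', i = i' + 1 := ⟨i - 1, by omega⟩
  by_contra h
  obtain ⟨w, hw⟩ := P.exact_mod_vars hm le_rfl hi
    (P.diffLin_mem_top (Pi.single ⟨0, Nat.pos_of_ne_zero h⟩ 1))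
  exact single_notMem_initialVars _ (by simpa using add_mem hw (P.diffLin_mem_top w))

/-! ### The top Koszul homology -/

/-- The boundaries of `F_r` modulo the first `r + 1` variables. -/
noncomputable def boundaries (r : ℕ) : Submodule (MvPolynomial (Fin m) k) (P.Free r) :=
  LinearMap.range (P.diffLin r) ⊔ initialVars k m (r + 1) (P.rank r)

variable {P} in
lemma mem_boundaries {r : ℕ} {v : P.Free r} :
    v ∈ P.boundaries r ↔ ∃ w, v - P.diffLin r w ∈ initialVars k m (r + 1) (P.rank r) := by
  rw [boundaries, Submodule.mem_sup]
  constructor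
  · rintro ⟨_, ⟨w, rfl⟩, z, hz, rfl⟩
    exact ⟨w, by simpa using hz⟩
  · rintro ⟨w, hw⟩
    exact ⟨_, ⟨w, rfl⟩, _, hw, by simp⟩

/-- The relation between cycles of `F_r` modulo the first `r + 1` variables and elements of `F₀`
that is given by iterated connecting homomorphisms. -/
def Connects : ∀ r, P.Free r → P.Free 0 → Prop
  | 0 => fun v u => v = u
  | r + 1 => fun v u => ∃ w, Connects r w u ∧
      P.diffLin r v - var k m (r + 1) • w ∈ initialVars k m (r + 1) (P.rank r)

variable {P}

lemma Connects.add {r : ℕ} : ∀ {v v' : P.Free r} {u u' : P.Free 0},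
    P.Connects r v u → P.Connects r v' u' → P.Connects r (v + v') (u + u') := by
  induction r with
  | zero => rintro v v' _ _ rfl rfl; rfl
  | succ r ih =>
    rintro v v' u u' ⟨w, hw, hvw⟩ ⟨w', hw', hvw'⟩
    refine ⟨w + w', ih hw hw', ?_⟩
    rw [map_add, smul_add, add_sub_add_comm]
    exact add_mem hvw hvw'

lemma Connects.smul {r : ℕ} (p : MvPolynomial (Fin m) k) : ∀ {v : P.Free r} {u : P.Free 0},
    P.Connects r v u → P.Connects r (p • v) (p • u) := by
  induction r with
  | zero => rintro v _ rfl; rfl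
  | succ r ih =>
    rintro v u ⟨w, hw, hvw⟩
    refine ⟨p • w, ih hw, ?_⟩
    rw [map_smul, smul_comm _ p, ← smul_sub]
    exact Submodule.smul_mem _ p hvw

/-- Each step is the connecting map of multiplication by `x_{r+1}` on the complex modulo `x_0, …,
x_r`. The forward direction (well-definedness) is cancellation of `x_{r+1}`; the backward one
(injectivity) is the vanishing of the homology at `F_{r+1}`, from `exact_mod_vars`. -/
lemma mem_boundaries_iff_of_connects {r : ℕ} (hr : r < m) : ∀ {v : P.Free r} {u : P.Free 0},
    P.Connects r v u → (v ∈ P.boundaries r ↔ u ∈ P.boundaries 0) := by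
  induction r with
  | zero =>
    intro v u h
    rw [show v = u from h]
  | succ r ih =>
    intro v u h
    obtain ⟨w, hw, hvw⟩ := h
    rw [← ih (by omega) hw, mem_boundaries, mem_boundaries]
    constructor
    · rintro ⟨v', hv'⟩
      obtain ⟨y, hy⟩ := (mem_initialVars_succ hr).1 hv'
      have h1 := diffLin_mem hy
      rw [map_sub, map_sub, diffLin_diffLin, sub_zero, map_smul] at h1
      refine ⟨y, mem_of_var_smul_mem hr ?_⟩
      convert sub_mem h1 hvw using 1
      module
    · rintro ⟨y, hy⟩
      have h1 : P.diffLin r (v - var k m (r + 1) • y) ∈ initialVars k m (r + 1) (P.rank r) := by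
        convert add_mem hvw (Submodule.smul_mem _ (var k m (r + 1)) hy) using 1
        rw [map_sub, map_smul]
        module
      obtain ⟨v', hv'⟩ := P.exact_mod_vars (by omega) hr.le le_rfl h1
      refine ⟨v', ?_⟩
      convert add_mem (initialVars_mono (Nat.le_succ _) hv') (var_smul_mem_initialVars hr y) using 1
      module

lemma exists_connects {r : ℕ} (hr : r + 1 < m) : ∀ {v : P.Free (r + 1)},
    P.diffLin r v ∈ initialVars k m (r + 2) (P.rank r) → ∃ u, P.Connects (r + 1) v u := by
  induction r with
  | zero =>
    intro v hv
    obtain ⟨w, hw⟩ := (mem_initialVars_succ hr).1 hv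
    exact ⟨w, w, rfl, hw⟩
  | succ r ih =>
    intro v hv
    obtain ⟨w, hw⟩ := (mem_initialVars_succ hr).1 hv
    have h1 := diffLin_mem hw
    rw [map_sub, diffLin_diffLin, zero_sub, map_smul, neg_mem_iff] at h1
    obtain ⟨u, hu⟩ := ih (by omega) (mem_of_var_smul_mem hr h1)
    exact ⟨u, w, hu, hw⟩

/-- The image of a connecting map is the part killed by the next variable. Together with the
converse `exists_connects_of_var_smul`, this identifies the homology at `F_r` with the elements of
`F₀ / boundaries` killed by `x_1, …, x_r`. -/
lemma var_smul_mem_boundaries {r : ℕ} (hr : r < m) : ∀ {v : P.Free r} {u : P.Free 0},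
    P.Connects r v u → ∀ j, 1 ≤ j → j ≤ r → var k m j • u ∈ P.boundaries 0 := by
  induction r with
  | zero => intro v u _ j h1 h2; omega
  | succ r ih =>
    intro v u h j h1 h2
    obtain ⟨w, hw, hvw⟩ := h
    rcases h2.lt_or_eq with h2 | rfl
    · exact ih (by omega) hw j h1 (by omega)
    · rw [← mem_boundaries_iff_of_connects (by omega)
        (hw.smul (var k m (r + 1))), mem_boundaries]
      exact ⟨v, by simpa using neg_mem hvw⟩

lemma exists_connects_of_var_smul {r : ℕ} (hr : r < m) {u : P.Free 0}
    (hu : ∀ j, 1 ≤ j → j ≤ r → var k m j • u ∈ P.boundaries 0) : ∃ v, P.Connects r v u := by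
  induction r with
  | zero => exact ⟨u, rfl⟩
  | succ r ih =>
    obtain ⟨w, hw⟩ := ih (by omega) fun j h1 h2 => hu j h1 (by omega)
    have h := hu (r + 1) (by omega) le_rfl
    rw [← mem_boundaries_iff_of_connects (by omega)
        (hw.smul (var k m (r + 1))), mem_boundaries] at h
    obtain ⟨v, hv⟩ := h
    exact ⟨v, w, hw, by simpa using neg_mem hv⟩

/-- Every connecting step divides by one variable `x_j`, `1 ≤ j ≤ r`, and so lowers the degree by `d
j`. -/
lemma vecComponent_connects {r : ℕ} (hr : r < m) (c : ℕ) :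
    ∀ {v : P.Free r} {u : P.Free 0}, P.Connects r v u →
    P.Connects r
      (vecComponent d (P.deg r) (c + ∑ j : Fin m with 1 ≤ j.val ∧ j.val ≤ r, d j) v)
      (vecComponent d (P.deg 0) c u) := by
  induction r with
  | zero =>
    intro v u h
    obtain rfl := show v = u from h
    have : ({j : Fin m | 1 ≤ j.val ∧ j.val ≤ 0} : Finset (Fin m)) = ∅ := by
      ext j; simp; omega
    rw [this]
    exact congrArg (fun c' => vecComponent d (P.deg 0) c' v) (by simp)
  | succ r ih =>
    intro v u h
    obtain ⟨w, hw, hvw⟩ := h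
    refine ⟨_, ih (by omega) hw, ?_⟩
    have hsum : ∑ j : Fin m with 1 ≤ j.val ∧ j.val ≤ r + 1, d j =
        (∑ j : Fin m with 1 ≤ j.val ∧ j.val ≤ r, d j) + d ⟨r + 1, hr⟩ := by
      have : ({j : Fin m | 1 ≤ j.val ∧ j.val ≤ r + 1} : Finset (Fin m)) =
          insert ⟨r + 1, hr⟩ ({j : Fin m | 1 ≤ j.val ∧ j.val ≤ r} : Finset (Fin m)) := by
        ext j; simp [Fin.ext_iff]; omega
      rw [this, Finset.sum_insert (by simp), add_comm]
    have h1 := vecComponent_mem_initialVars d (P.deg r)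
      (c + ∑ j : Fin m with 1 ≤ j.val ∧ j.val ≤ r + 1, d j) hvw
    rw [map_sub, vecComponent_diffLin] at h1
    convert h1 using 2
    rw [hsum, ← add_assoc, var, dif_pos hr, vecComponent_X_smul]

end Koszul

end MinimalGradedFreeResolution
/-! ### Homogeneous elements of the semigroup ring -/

section Components

variable {k : Type*} [Field k] {m : ℕ}

lemma exists_sum_vecComponent {r : ℕ} (d : Fin m → ℕ) (e : Fin r → ℕ)
    (v : Fin r → MvPolynomial (Fin m) k) :
    ∃ T : Finset ℕ, v = ∑ c ∈ T, vecComponent d e c v := by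
  classical
  refine ⟨Finset.univ.biUnion fun a => (v a).support.image fun u => Finsupp.weight d u + e a, ?_⟩
  ext a u
  simp only [Finset.sum_apply, coeff_sum, coeff_vecComponent, Finset.sum_ite_eq]
  split_ifs with h
  · rfl
  · by_contra h0
    refine h (Finset.mem_biUnion.2 ⟨a, Finset.mem_univ _, Finset.mem_image.2 ⟨u, ?_, rfl⟩⟩)
    exact mem_support_iff.2 h0

lemma vecComponent_single_one {r : ℕ} (d : Fin m → ℕ) (e : Fin r → ℕ) (j : Fin r) (c : ℕ) :
    vecComponent d e c (Pi.single j (1 : MvPolynomial (Fin m) k)) =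
      if e j = c then Pi.single j 1 else 0 := by
  classical
  ext a u
  rw [coeff_vecComponent]
  rcases eq_or_ne a j with rfl | ha
  · rw [Pi.single_eq_same, coeff_one]
    by_cases hu : 0 = u
    · subst hu
      split_ifs <;> simp_all
    · rw [if_neg hu, ite_self]
      split_ifs
      · rw [Pi.single_eq_same, coeff_one, if_neg hu]
      · simp
  · split_ifs <;> simp [ha]

lemma paramMap_monomial (d : Fin m → ℕ) (u : Fin m →₀ ℕ) (b : k) :
    paramMap k d (monomial u b) = Polynomial.monomial (Finsupp.weight d u) b := by
  rw [paramMap, aeval_monomial, ← Polynomial.C_mul_X_pow_eq_monomial]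
  congr 1
  rw [Finsupp.weight_apply, Finsupp.prod, Finsupp.sum, ← Finset.prod_pow_eq_pow_sum]
  exact Finset.prod_congr rfl fun i _ => by rw [← pow_mul, mul_comm, smul_eq_mul, mul_comm]

lemma paramMap_shiftedComponent (d : Fin m → ℕ) (α c : ℕ) (q : MvPolynomial (Fin m) k) (t : k) :
    paramMap k d (shiftedComponent d α c q) * Polynomial.monomial α t =
      Polynomial.monomial c ((paramMap k d q * Polynomial.monomial α t).coeff c) := by
  induction q using MvPolynomial.induction_on' with
  | monomial u b =>
    have : shiftedComponent d α c (monomial u b) =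
        if Finsupp.weight d u + α = c then monomial u b else 0 := by
      classical
      ext u'
      rw [coeff_shiftedComponent]
      rcases eq_or_ne u u' with rfl | h
      · split_ifs <;> simp
      · split_ifs <;> simp [h]
    rw [this, paramMap_monomial, Polynomial.monomial_mul_monomial, Polynomial.coeff_monomial]
    split_ifs with h
    · rw [paramMap_monomial, Polynomial.monomial_mul_monomial, h]
    · simp
  | add p q hp hq => rw [map_add, map_add, add_mul, hp, hq, map_add, add_mul, Polynomial.coeff_add,
      map_add]

lemma mem_semigroup_iff {d : Fin m → ℕ} {s : ℕ} :
    s ∈ semigroup d ↔ ∃ u : Fin m →₀ ℕ, Finsupp.weight d u = s := by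
  constructor
  · intro h
    induction h using AddSubmonoid.closure_induction with
    | mem x hx =>
      obtain ⟨i, rfl⟩ := hx
      exact ⟨Finsupp.single i 1, by simp [Finsupp.weight_apply]⟩
    | zero => exact ⟨0, by simp⟩
    | add x y _ _ hx hy =>
      obtain ⟨u, rfl⟩ := hx
      obtain ⟨v, rfl⟩ := hy
      exact ⟨u + v, by simp⟩
  · rintro ⟨u, rfl⟩
    rw [Finsupp.weight_apply]
    exact AddSubmonoid.sum_mem _ fun i _ => AddSubmonoid.nsmul_mem _
      (AddSubmonoid.subset_closure (Set.mem_range_self i)) _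

lemma mem_semigroupRing_iff {d : Fin m → ℕ} {p : Polynomial k} :
    p ∈ semigroupRing k d ↔ ∃ q, paramMap k d q = p := by
  rw [semigroupRing, Algebra.adjoin_range_eq_range_aeval]
  rfl

lemma mem_semigroup_of_coeff_ne_zero {d : Fin m → ℕ} {p : Polynomial k}
    (hp : p ∈ semigroupRing k d) {s : ℕ} (hs : p.coeff s ≠ 0) : s ∈ semigroup d := by
  obtain ⟨q, rfl⟩ := mem_semigroupRing_iff.1 hp
  by_contra h
  refine hs ?_
  clear hs hp
  induction q using MvPolynomial.induction_on' with
  | monomial u b =>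
    rw [paramMap_monomial, Polynomial.coeff_monomial, if_neg]
    exact fun hu => h (mem_semigroup_iff.2 ⟨u, hu⟩)
  | add p q hp hq => rw [map_add, Polynomial.coeff_add, hp, hq, add_zero]

lemma X_pow_mem_semigroupRing {d : Fin m → ℕ} {s : ℕ} (hs : s ∈ semigroup d) :
    (Polynomial.X : Polynomial k) ^ s ∈ semigroupRing k d := by
  obtain ⟨u, hu⟩ := mem_semigroup_iff.1 hs
  exact mem_semigroupRing_iff.2 ⟨monomial u 1, by
    rw [paramMap_monomial, hu, Polynomial.monomial_one_right_eq_X_pow]⟩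

end Components

/-! ### The last module and the socle of `k[S]/(z^{d₁})` -/

namespace MinimalGradedFreeResolution

section Degrees

variable {k : Type*} [Field k] {m : ℕ} {d : Fin m → ℕ} (P : MinimalGradedFreeResolution k d)

lemma augLin_vecComponent (c : ℕ) (v : P.Free 0) :
    P.augLin (vecComponent d (P.deg 0) c v) = Polynomial.monomial c ((P.augLin v).coeff c) := by
  simp only [augLin_apply, Polynomial.finsetSum_coeff, map_sum]
  refine Finset.sum_congr rfl fun j _ => ?_
  obtain ⟨t, ht⟩ := P.aug_homogeneous j
  rw [ht]
  exact paramMap_shiftedComponent d (P.deg 0 j) c (v j) t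

lemma augLin_mem (v : P.Free 0) : P.augLin v ∈ semigroupRing k d := by
  rw [augLin_apply]
  exact P.range_aug.subset ⟨v, rfl⟩

lemma exists_augLin_eq {p : Polynomial k} (hp : p ∈ semigroupRing k d) : ∃ v, P.augLin v = p := by
  obtain ⟨v, hv⟩ := P.range_aug.superset hp
  exact ⟨v, by rw [augLin_apply]; exact hv⟩

/-- `F₀` has rank `1`, and its basis element is mapped to a nonzero constant. -/
lemma exists_unique_generator :
    ∃ b, (∀ j, j = b) ∧ P.deg 0 b = 0 ∧ ∃ t : k, t ≠ 0 ∧ P.aug b = Polynomial.C t := by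
  obtain ⟨v, hv⟩ := P.exists_augLin_eq (one_mem _)
  obtain ⟨b, hb⟩ : ∃ b, (paramMap k d (v b) * P.aug b).coeff 0 ≠ 0 := by
    by_contra! h
    have := congrArg (fun p => p.coeff 0) hv
    simp only [augLin_apply, Polynomial.finsetSum_coeff, h] at this
    simp at this
  obtain ⟨t, ht⟩ := P.aug_homogeneous b
  rw [Polynomial.mul_coeff_zero, ht, Polynomial.coeff_monomial] at hb
  have hdeg : P.deg 0 b = 0 := by by_contra h; simp [h] at hb
  have ht0 : t ≠ 0 := by rintro rfl; simp at hb
  have haug : P.aug b = Polynomial.C t := by rw [ht, hdeg, Polynomial.monomial_zero_left]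
  refine ⟨b, fun j => ?_, hdeg, t, ht0, haug⟩
  -- The image of another basis element is already a multiple of the image of the `b`-th one. The
  -- difference is a relation with a coefficient `1`, against minimality.
  by_contra hjb
  obtain ⟨p, hp⟩ := mem_semigroupRing_iff.1 (P.augLin_mem (Pi.single j 1))
  have hs : ∀ (i : Fin (P.rank 0)) (q : MvPolynomial (Fin m) k),
      P.augLin (Pi.single i q) = paramMap k d q * P.aug i := by
    intro i q
    rw [augLin_apply, Finset.sum_eq_single i] <;> simp +contextual
  have h0 : P.augLin (Pi.single j 1 - Pi.single b (C t⁻¹ * p)) = 0 := by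
    rw [map_sub, hs b, map_mul, hp, haug]
    have : paramMap k d (C t⁻¹) = Polynomial.C t⁻¹ := by simp [paramMap]
    rw [this, mul_right_comm, ← Polynomial.C_mul, inv_mul_cancel₀ ht0, Polynomial.C_1, one_mul,
      sub_self]
  obtain ⟨w, hw⟩ := P.augLin_eq_zero_iff.1 h0
  have h1 := P.diffLin_mem_top w
  rw [hw, mem_initialVars_top] at h1
  simpa [hjb] using h1 j

variable {P}

/-- `F₀` modulo `boundaries 0` is `k[S]/z^{d₁} k[S]`, where `z^s` vanishes exactly when `s - d₁ ∈
S`. -/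
lemma mem_boundaries_zero_iff (hm : 0 < m) {u : P.Free 0} {s : ℕ} {t : k} (ht : t ≠ 0)
    (hu : P.augLin u = Polynomial.monomial s t) :
    u ∈ P.boundaries 0 ↔ ∃ s' ∈ semigroup d, s = d ⟨0, hm⟩ + s' := by
  rw [mem_boundaries]
  constructor
  · rintro ⟨w, hw⟩
    obtain ⟨y, hy⟩ := (mem_initialVars_succ hm).1 hw
    rw [initialVars_zero, Submodule.mem_bot, sub_eq_zero] at hy
    have h := congrArg P.augLin hy
    rw [map_sub, augLin_diffLin, sub_zero, hu, augLin_smul, paramMap_var hm] at h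
    have h1 := congrArg (fun p => p.coeff s) h
    simp only [Polynomial.coeff_monomial, if_true, Polynomial.coeff_X_pow_mul'] at h1
    split_ifs at h1 with hs
    · exact ⟨s - d ⟨0, hm⟩, mem_semigroup_of_coeff_ne_zero (P.augLin_mem y) (h1 ▸ ht), by omega⟩
    · exact absurd h1 ht
  · rintro ⟨s', hs', rfl⟩
    obtain ⟨y, hy⟩ := P.exists_augLin_eq (X_pow_mem_semigroupRing hs')
    have h0 : P.augLin (u - var k m 0 • t • y) = 0 := by
      rw [map_sub, augLin_smul, paramMap_var hm, map_smul, hy, hu, mul_smul_comm, ← pow_add,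
        ← Polynomial.monomial_one_right_eq_X_pow, Polynomial.smul_monomial, smul_eq_mul, mul_one,
        sub_self]
    obtain ⟨w, hw⟩ := P.augLin_eq_zero_iff.1 h0
    exact ⟨w, by rw [hw, sub_sub_cancel]; exact var_smul_mem_initialVars hm _⟩

lemma augLin_var_smul {i : ℕ} (hi : i < m) {u : P.Free 0} {s : ℕ} {t : k}
    (hu : P.augLin u = Polynomial.monomial s t) :
    P.augLin (var k m i • u) = Polynomial.monomial (s + d ⟨i, hi⟩) t := by
  rw [augLin_smul, paramMap_var hi, hu, Polynomial.X_pow_mul_monomial]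

/-- `s - d₁` is a pseudo-Frobenius number. -/
def IsSocleDegree (d : Fin m → ℕ) (hm : 0 < m) (s : ℕ) : Prop :=
  s ∈ semigroup d ∧ (¬ ∃ s' ∈ semigroup d, s = d ⟨0, hm⟩ + s') ∧
    ∀ i : Fin m, 1 ≤ i.val → ∃ s' ∈ semigroup d, s + d i = d ⟨0, hm⟩ + s'

variable {r : ℕ} (hr : r + 1 = m)

include hr in
lemma mem_boundaries_last {v : P.Free r} :
    v ∈ P.boundaries r ↔ v ∈ initialVars k m m (P.rank r) := by
  subst hr
  rw [mem_boundaries]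
  constructor
  · rintro ⟨w, hw⟩
    simpa using add_mem hw (P.diffLin_mem_top w)
  · exact fun h => ⟨0, by simpa using h⟩

include hr in
lemma single_notMem_boundaries_last (j : Fin (P.rank r)) :
    (Pi.single j 1 : P.Free r) ∉ P.boundaries r :=
  fun h => single_notMem_initialVars j ((mem_boundaries_last hr).1 h)

/-- By minimality a basis vector of `F_{m-1}` is a cycle modulo all variables, and it is not a
boundary. Some homogeneous component of the connected element of `F₀` therefore survives, and the
degree shift forces its degree. -/
lemma exists_connects_last (j : Fin (P.rank r)) :
    ∃ s, IsSocleDegree d (by omega) s ∧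
      P.deg r j = s + ∑ j : Fin m with 1 ≤ j.val ∧ j.val ≤ r, d j ∧
      ∃ u t, t ≠ 0 ∧ P.augLin u = Polynomial.monomial s t ∧ P.Connects r (Pi.single j 1) u := by
  obtain ⟨u, hu⟩ : ∃ u, P.Connects r (Pi.single j 1) u := by
    cases r with
    | zero => exact ⟨_, rfl⟩
    | succ r =>
      refine exists_connects (by omega) ?_
      subst hr
      exact P.diffLin_mem_top _
  have hj := single_notMem_boundaries_last hr j
  have hu0 : u ∉ P.boundaries 0 := by
    rwa [← mem_boundaries_iff_of_connects (by omega) hu]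
  obtain ⟨s, hs⟩ : ∃ s, vecComponent d (P.deg 0) s u ∉ P.boundaries 0 := by
    by_contra! h
    obtain ⟨T, hT⟩ := exists_sum_vecComponent d (P.deg 0) u
    exact hu0 (hT ▸ Submodule.sum_mem _ fun c _ => h c)
  have hc := vecComponent_connects (by omega) s hu
  have hdeg : P.deg r j = s + ∑ j : Fin m with 1 ≤ j.val ∧ j.val ≤ r, d j := by
    by_contra h
    rw [vecComponent_single_one, if_neg h] at hc
    exact hs ((mem_boundaries_iff_of_connects (by omega) hc).1 (zero_mem _))
  rw [vecComponent_single_one, if_pos hdeg] at hc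
  have haug := P.augLin_vecComponent s u
  have ht : (P.augLin u).coeff s ≠ 0 := by
    intro h
    rw [h, map_zero, augLin_eq_zero_iff] at haug
    obtain ⟨w, hw⟩ := haug
    exact hs (mem_boundaries.2 ⟨w, by rw [hw, sub_self]; exact zero_mem _⟩)
  refine ⟨s, ⟨mem_semigroup_of_coeff_ne_zero (P.augLin_mem u) ht, ?_, fun i hi => ?_⟩, hdeg,
    _, _, ht, haug, hc⟩
  · rwa [← mem_boundaries_zero_iff (by omega) ht haug]
  · rw [← mem_boundaries_zero_iff (by omega) ht (augLin_var_smul i.isLt haug)]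
    exact var_smul_mem_boundaries (by omega) hc i hi (by omega)

-- `k[S]` has dimension at most one in each degree. Two basis vectors of equal degree would have a
-- combination with nonzero scalar coefficients connected to an element of augmentation zero, so
-- this combination would be a boundary, against minimality.
include hr in
lemma deg_last_injective : Function.Injective (P.deg r) := by
  intro j j' h
  obtain ⟨s, -, hs, u, t, ht, hu, hc⟩ := exists_connects_last hr j
  obtain ⟨s', -, hs', u', t', ht', hu', hc'⟩ := exists_connects_last hr j'
  obtain rfl : s = s' := by omega
  by_contra hne
  have hcc := (hc.smul (C t' : MvPolynomial (Fin m) k)).add (hc'.smul (-C t : MvPolynomial (Fin m) k))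
  have h0 : P.augLin ((C t' : MvPolynomial (Fin m) k) • u + (-C t : MvPolynomial (Fin m) k) • u') = 0 := by
    rw [map_add, P.augLin_smul, P.augLin_smul, hu, hu', map_neg]
    simp [paramMap, Polynomial.C_mul_monomial, mul_comm]
  obtain ⟨w, hw⟩ := P.augLin_eq_zero_iff.1 h0
  have h1 := (mem_boundaries_iff_of_connects (by omega) hcc).2
    (mem_boundaries.2 ⟨w, by rw [hw, sub_self]; exact zero_mem _⟩)
  rw [mem_boundaries_last hr, mem_initialVars_top] at h1
  have h2 := h1 j
  simp [hne, ht'] at h2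

lemma exists_deg_last {s : ℕ} (hs : IsSocleDegree d (by omega) s) :
    ∃ j, P.deg r j = s + ∑ j : Fin m with 1 ≤ j.val ∧ j.val ≤ r, d j := by
  obtain ⟨hsS, hs1, hs2⟩ := hs
  obtain ⟨u, hu⟩ := P.exists_augLin_eq (k := k) (X_pow_mem_semigroupRing hsS)
  rw [← Polynomial.monomial_one_right_eq_X_pow] at hu
  obtain ⟨v, hv⟩ := exists_connects_of_var_smul (P := P) (r := r) (by omega) (u := u)
    fun i hi hir => (mem_boundaries_zero_iff (by omega) one_ne_zero
      (augLin_var_smul (by omega) hu)).2 (hs2 ⟨i, by omega⟩ hi)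
  have hc := vecComponent_connects (by omega) s hv
  have haug := P.augLin_vecComponent s u
  rw [hu, Polynomial.coeff_monomial, if_pos rfl] at haug
  have h1 := mt (mem_boundaries_iff_of_connects (by omega) hc).1
    (mt (mem_boundaries_zero_iff (by omega) one_ne_zero haug).1 hs1)
  rw [mem_boundaries_last hr, mem_initialVars_top] at h1
  push Not at h1
  obtain ⟨a, ha⟩ := h1
  rw [constantCoeff_eq, coeff_vecComponent] at ha
  refine ⟨a, ?_⟩
  by_contra h
  simp [h] at ha

end Degrees

end MinimalGradedFreeResolution
/-! ### Gaps and pseudo-Frobenius numbers -/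

section Gaps

variable {m : ℕ} {d : Fin m → ℕ}

lemma mem_semigroup_self (i : Fin m) : d i ∈ semigroup d :=
  AddSubmonoid.subset_closure (Set.mem_range_self i)

lemma natCast_mem_semigroupInt {s : ℕ} : (s : ℤ) ∈ semigroupInt d ↔ s ∈ semigroup d :=
  ⟨fun ⟨t, ht, hts⟩ => by rwa [← Nat.cast_inj.1 hts], fun h => ⟨s, h, rfl⟩⟩

lemma nonneg_of_mem_semigroupInt {z : ℤ} (h : z ∈ semigroupInt d) : 0 ≤ z := by
  obtain ⟨s, -, rfl⟩ := h
  positivity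

lemma zero_mem_semigroupInt : (0 : ℤ) ∈ semigroupInt d := ⟨0, zero_mem _, rfl⟩

lemma add_mem_semigroupInt {y z : ℤ} (hy : y ∈ semigroupInt d) (hz : z ∈ semigroupInt d) :
    y + z ∈ semigroupInt d := by
  obtain ⟨s, hs, rfl⟩ := hy
  obtain ⟨t, ht, rfl⟩ := hz
  exact ⟨s + t, add_mem hs ht, by push_cast; rfl⟩

lemma IsMinimalGenerators.conductor_spec (hd : IsMinimalGenerators d) :
    conductor d ∈ semigroup d ∧ ∀ x : ℕ, conductor d + x ∈ semigroup d := by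
  have hgcd : Nat.setGcd (Set.range d) = 1 := by
    refine Nat.dvd_one.1 ?_
    rw [← hd.gcd_eq_one]
    exact Finset.dvd_gcd fun i _ => Nat.setGcd_dvd_of_mem (Set.mem_range_self i)
  obtain ⟨N, hN⟩ := Nat.exists_mem_closure_of_ge (Set.range d)
  refine Nat.sInf_mem (s := {c | c ∈ semigroup d ∧ ∀ x : ℕ, c + x ∈ semigroup d})
    ⟨N, hN N le_rfl (by simp [hgcd]), fun x => hN _ (by omega) (by simp [hgcd])⟩

lemma IsMinimalGenerators.mem_of_frobenius_lt (hd : IsMinimalGenerators d) {z : ℤ}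
    (hz : frobenius d < z) : z ∈ semigroupInt d := by
  unfold frobenius at hz
  obtain ⟨x, rfl⟩ : ∃ x : ℕ, z = ((conductor d + x : ℕ) : ℤ) :=
    ⟨(z - conductor d).toNat, by push_cast; omega⟩
  exact natCast_mem_semigroupInt.2 (hd.conductor_spec.2 x)

lemma IsMinimalGenerators.frobenius_notMem (hd : IsMinimalGenerators d) :
    frobenius d ∉ semigroupInt d := by
  rintro ⟨s, hs, hsF⟩
  unfold frobenius at hsF
  have : conductor d ≤ s := Nat.sInf_le (m := s) ⟨hs, fun x => by
    cases x with
    | zero => exact hs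
    | succ x =>
      have := hd.conductor_spec.2 x
      rwa [show s + (x + 1) = conductor d + x by omega]⟩
  omega

lemma IsMinimalGenerators.frobenius_pos (hd : IsMinimalGenerators d) (hm : 2 ≤ m) :
    0 < frobenius d := by
  by_contra hF
  -- Here `1 ∈ S`, so some generator equals `1`, and any other generator is a multiple of it.
  obtain ⟨s, hs, hs1⟩ := hd.mem_of_frobenius_lt (show frobenius d < 1 by omega)
  obtain rfl : s = 1 := by exact_mod_cast hs1
  obtain ⟨u, hu⟩ := mem_semigroup_iff.1 hs
  obtain ⟨i, hi⟩ : ∃ i, u i ≠ 0 := by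
    by_contra! h
    rw [show u = 0 from Finsupp.ext h, map_zero] at hu
    exact zero_ne_one hu
  have hle : d i ≤ 1 := by
    rw [← hu]
    exact Finsupp.le_weight_of_ne_zero' d hi
  have hdi : d i = 1 := le_antisymm hle (hd.pos i)
  have : Nontrivial (Fin m) := Fin.nontrivial_iff_two_le.2 hm
  obtain ⟨j, hj⟩ := exists_ne i
  refine hd.minimal j ?_
  have := AddSubmonoid.nsmul_mem (AddSubmonoid.closure (d '' {l | l ≠ j}))
    (AddSubmonoid.subset_closure ⟨i, hj.symm, rfl⟩) (d j)
  simpa [hdi] using this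

lemma IsMinimalGenerators.mem_gaps (hd : IsMinimalGenerators d) {g : ℤ} :
    g ∈ gaps d ↔ 0 < g ∧ g ∉ semigroupInt d := by
  simp only [gaps, Finset.mem_filter, Finset.mem_Icc]
  refine ⟨fun h => ⟨by omega, h.2⟩, fun h => ⟨⟨by omega, ?_⟩, h.2⟩⟩
  by_contra hg
  exact h.2 (hd.mem_of_frobenius_lt (by omega))

lemma mem_gapsH {h : ℤ} : h ∈ gapsH d ↔ h ∈ gaps d ∧ frobenius d - h ∉ semigroupInt d := by
  simp [gapsH]

lemma IsMinimalGenerators.sub_mem_gapsH (hd : IsMinimalGenerators d) {h : ℤ} (hh : h ∈ gapsH d) :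
    frobenius d - h ∈ gapsH d := by
  rw [mem_gapsH] at hh ⊢
  have h0 := hd.mem_gaps.1 hh.1
  have h1 : h ≤ frobenius d := by
    by_contra hlt
    exact h0.2 (hd.mem_of_frobenius_lt (by omega))
  refine ⟨hd.mem_gaps.2 ⟨?_, hh.2⟩, by rw [sub_sub_cancel]; exact h0.2⟩
  have : h ≠ frobenius d := by
    rintro rfl
    exact hh.2 (by rw [sub_self]; exact zero_mem_semigroupInt)
  omega

lemma frobenius_notMem_gapsH : frobenius d ∉ gapsH d := fun h =>
  (mem_gapsH.1 h).2 (by rw [sub_self]; exact zero_mem_semigroupInt)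

lemma IsMinimalGenerators.mem_pseudoFrobenius (hd : IsMinimalGenerators d)
    (hS : IsAlmostSymmetric d) {f : ℤ} :
    f ∈ pseudoFrobenius d ↔ f ∈ insert (frobenius d) (gapsH d) := by
  have h : f ∈ pseudoFrobenius d \ {frobenius d} ↔ f ∈ (gapsH d : Set ℤ) := by rw [hS]
  simp only [Set.mem_sdiff, Set.mem_singleton_iff, Finset.mem_coe] at h
  rw [Finset.mem_insert, ← h]
  refine ⟨fun hf => by tauto, ?_⟩
  rintro (rfl | hf)
  · refine ⟨hd.frobenius_notMem, fun s hs hs0 => hd.mem_of_frobenius_lt ?_⟩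
    have := nonneg_of_mem_semigroupInt hs
    omega
  · exact hf.1

lemma IsMinimalGenerators.mem_pseudoFrobenius_iff (hd : IsMinimalGenerators d) {f : ℤ} :
    f ∈ pseudoFrobenius d ↔ f ∉ semigroupInt d ∧ ∀ i, f + d i ∈ semigroupInt d := by
  refine ⟨fun h => ⟨h.1, fun i => h.2 _ (natCast_mem_semigroupInt.2 (mem_semigroup_self i))
    (by have := hd.pos i; omega)⟩, fun h => ⟨h.1, ?_⟩⟩
  rintro _ ⟨s, hs, rfl⟩ hs0
  obtain ⟨u, rfl⟩ := mem_semigroup_iff.1 hs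
  obtain ⟨i, hi⟩ : ∃ i, u i ≠ 0 := by
    by_contra! h
    rw [show u = 0 from Finsupp.ext h, map_zero] at hs0
    exact hs0 rfl
  obtain ⟨v, rfl⟩ : ∃ v, u = v + Finsupp.single i 1 :=
    ⟨u - Finsupp.single i 1, (tsub_add_cancel_of_le (by
      rw [Finsupp.single_le_iff]; omega)).symm⟩
  have := add_mem_semigroupInt (h.2 i)
    (natCast_mem_semigroupInt.2 (mem_semigroup_iff.2 ⟨v, rfl⟩))
  convert this using 1
  rw [map_add, Finsupp.weight_single]
  push_cast
  simp
  ring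

open MinimalGradedFreeResolution in
lemma IsMinimalGenerators.isSocleDegree_iff (hd : IsMinimalGenerators d) (hm : 0 < m) {s : ℕ} :
    IsSocleDegree d hm s ↔ (s : ℤ) - d ⟨0, hm⟩ ∈ pseudoFrobenius d := by
  have key : ∀ t : ℕ, (∃ s' ∈ semigroup d, t = d ⟨0, hm⟩ + s') ↔
      (t : ℤ) - d ⟨0, hm⟩ ∈ semigroupInt d := by
    intro t
    refine exists_congr fun s' => and_congr_right fun _ => ?_
    omega
  rw [hd.mem_pseudoFrobenius_iff, IsSocleDegree, key]
  constructor
  · rintro ⟨h1, h2, h3⟩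
    refine ⟨h2, fun i => ?_⟩
    by_cases hi : i = ⟨0, hm⟩
    · rw [hi, sub_add_cancel]
      exact natCast_mem_semigroupInt.2 h1
    · have := (key _).1 (h3 i (by
        rw [Fin.ext_iff] at hi
        change i.val ≠ 0 at hi
        omega))
      push_cast at this
      rwa [sub_add_eq_add_sub]
  · rintro ⟨h1, h2⟩
    refine ⟨natCast_mem_semigroupInt.1 (by simpa using h2 ⟨0, hm⟩), h1, fun i _ => ?_⟩
    rw [key]
    push_cast
    rw [← sub_add_eq_add_sub]
    exact h2 i

lemma genSum_eq (hm : 0 < m) {r : ℕ} (hr : r + 1 = m) :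
    genSum d = d ⟨0, hm⟩ + ((∑ j : Fin m with 1 ≤ j.val ∧ j.val ≤ r, d j : ℕ) : ℤ) := by
  have : (Finset.univ : Finset (Fin m)) =
      insert ⟨0, hm⟩ ({j : Fin m | 1 ≤ j.val ∧ j.val ≤ r} : Finset (Fin m)) := by
    ext j
    simp [Fin.ext_iff]
    omega
  rw [genSum, Finset.sum_congr this fun _ _ => rfl, Finset.sum_insert (by simp)]
  push_cast
  rfl

variable {k : Type*} [Field k]

/-- The socle degree `f + d₁` and the shift `d₂ + ⋯ + d_m` add up to `f + Σ`. Neither side has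
repetitions, so comparing elements suffices. -/
lemma syzygyDegrees_last (hd : IsMinimalGenerators d) (hS : IsAlmostSymmetric d)
    (P : MinimalGradedFreeResolution k d) {r : ℕ} (hr : r + 1 = m) :
    P.syzygyDegrees r = (insert (frobenius d) (gapsH d)).val.map fun f => f + genSum d := by
  rw [MinimalGradedFreeResolution.syzygyDegrees]
  refine (Multiset.Nodup.ext ?_ ?_).2 fun c => ?_
  · exact Finset.univ.nodup.map fun i j hij =>
      MinimalGradedFreeResolution.deg_last_injective hr (by simpa using hij)
  · exact (Finset.nodup _).map (add_left_injective _)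
  simp only [Multiset.mem_map, Finset.mem_val, Finset.mem_univ, true_and]
  rw [genSum_eq (by omega) hr]
  constructor
  · rintro ⟨j, rfl⟩
    obtain ⟨s, hs, hj, -⟩ := MinimalGradedFreeResolution.exists_connects_last hr j
    refine ⟨_, (hd.mem_pseudoFrobenius hS).1 ((hd.isSocleDegree_iff _).1 hs), ?_⟩
    rw [hj]
    push_cast
    ring
  · rintro ⟨f, hf, rfl⟩
    rw [← hd.mem_pseudoFrobenius hS] at hf
    obtain ⟨s, -, hs⟩ := (hd.mem_pseudoFrobenius_iff.1 hf).2 ⟨0, by omega⟩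
    obtain ⟨j, hj⟩ := MinimalGradedFreeResolution.exists_deg_last (P := P) hr
      ((hd.isSocleDegree_iff (by omega)).2 (by rwa [hs, add_sub_cancel_right]))
    refine ⟨j, ?_⟩
    rw [hj, ← add_assoc, ← hs]
    push_cast
    rfl

end Gaps
/-! ### The Hilbert series -/

section Hilbert

variable {m : ℕ}

/-- The number of monomials of weighted degree `n`. -/
noncomputable def monomialCount (d : Fin m → ℕ) (n : ℕ) : ℕ :=
  Nat.card {u : Fin m →₀ ℕ // Finsupp.weight d u = n}

lemma one_sub_X_pow_mul_mk {a : ℕ} (ha : 0 < a) :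
    (1 - (PowerSeries.X : PowerSeries ℤ) ^ a) * PowerSeries.mk (fun n => if a ∣ n then 1 else 0) =
      1 := by
  ext n
  rw [sub_mul, one_mul, map_sub, PowerSeries.coeff_X_pow_mul', PowerSeries.coeff_mk,
    PowerSeries.coeff_one]
  by_cases h : a ≤ n
  · rw [if_pos h, PowerSeries.coeff_mk, if_neg (by omega : ¬ n = 0)]
    obtain ⟨b, rfl⟩ := Nat.exists_eq_add_of_le h
    simp
  · rw [if_neg h]
    rcases Nat.eq_zero_or_pos n with rfl | hn
    · simp
    · rw [if_neg fun hdvd => h (Nat.le_of_dvd hn hdvd), if_neg hn.ne']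
      simp

/-- An exponent vector `u` corresponds to the tuple `l i = u i * d i` of multiples with sum `n`,
which is what the product of the series counts. -/
lemma mk_monomialCount {d : Fin m → ℕ} (hd : ∀ i, 0 < d i) :
    PowerSeries.mk (fun n => (monomialCount d n : ℤ)) =
      ∏ i, PowerSeries.mk (fun n => if d i ∣ n then (1 : ℤ) else 0) := by
  classical
  ext n
  rw [PowerSeries.coeff_mk, PowerSeries.coeff_prod]
  simp only [PowerSeries.coeff_mk, Finset.prod_ite_zero, Finset.prod_const_one, Finset.mem_univ,
    forall_true_left]
  rw [Finset.sum_boole, monomialCount, Nat.cast_inj, ← Fintype.card_coe,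
    ← Nat.card_eq_fintype_card]
  let f : {u : Fin m →₀ ℕ // Finsupp.weight d u = n} → {l : Fin m →₀ ℕ //
      l ∈ (Finset.univ.finsuppAntidiag n).filter fun l => ∀ i, d i ∣ l i} := fun u =>
    ⟨Finsupp.equivFunOnFinite.symm fun i => u.1 i * d i, by
      have := u.2
      rw [Finsupp.weight_apply, Finsupp.sum_fintype _ _ (by simp)] at this
      simpa using this⟩
  refine Nat.card_eq_of_bijective f ⟨?_, ?_⟩
  · intro u v huv
    ext i
    have := DFunLike.congr_fun (congrArg Subtype.val huv) i
    exact Nat.eq_of_mul_eq_mul_right (hd i) this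
  · rintro ⟨l, hl⟩
    have hl' := hl
    rw [Finset.mem_filter, Finset.mem_finsuppAntidiag] at hl'
    obtain ⟨⟨hl1, -⟩, hl2⟩ := hl'
    refine ⟨⟨Finsupp.equivFunOnFinite.symm fun i => l i / d i, ?_⟩, ?_⟩
    · rw [Finsupp.weight_apply, Finsupp.sum_fintype _ _ (by simp), ← hl1]
      exact Finset.sum_congr rfl fun i _ => Nat.div_mul_cancel (hl2 i)
    · ext i
      exact Nat.div_mul_cancel (hl2 i)

lemma prod_one_sub_mul_mk_monomialCount {d : Fin m → ℕ} (hd : ∀ i, 0 < d i) :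
    (∏ i, (1 - (PowerSeries.X : PowerSeries ℤ) ^ d i)) *
      PowerSeries.mk (fun n => (monomialCount d n : ℤ)) = 1 := by
  rw [mk_monomialCount hd, ← Finset.prod_mul_distrib]
  exact Finset.prod_eq_one fun i _ => one_sub_X_pow_mul_mk (hd i)

/-! ### Spaces of homogeneous vectors -/

variable {k : Type*} [Field k]

/-- The space of vectors that are homogeneous of degree `c`. -/
noncomputable def homogeneousVectors (k : Type*) [Field k] {r : ℕ} (d : Fin m → ℕ)
    (e : Fin r → ℕ) (c : ℕ) : Submodule k (Fin r → MvPolynomial (Fin m) k) :=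
  LinearMap.range (vecComponent d e c)

lemma mem_homogeneousVectors {r : ℕ} {d : Fin m → ℕ} {e : Fin r → ℕ} {c : ℕ}
    {v : Fin r → MvPolynomial (Fin m) k} :
    v ∈ homogeneousVectors k d e c ↔ vecComponent d e c v = v := by
  refine ⟨?_, fun h => ⟨v, h⟩⟩
  rintro ⟨w, rfl⟩
  ext a u
  simp only [coeff_vecComponent]
  split_ifs <;> rfl

/-- The monomials of degree `c` in a free module whose basis elements have the degrees `e`. -/
abbrev VecMonomial {r : ℕ} (d : Fin m → ℕ) (e : Fin r → ℕ) (c : ℕ) : Type :=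
  Σ a : Fin r, {u : Fin m →₀ ℕ // Finsupp.weight d u + e a = c}

lemma finite_vecMonomial {r : ℕ} {d : Fin m → ℕ} (hd : ∀ i, 0 < d i) (e : Fin r → ℕ) (c : ℕ) :
    Finite (VecMonomial d e c) := by
  have : ∀ a, Finite {u : Fin m →₀ ℕ // Finsupp.weight d u + e a = c} := fun a =>
    ((Finsupp.finite_of_nat_weight_le d (fun i => (hd i).ne') c).subset
      fun u (hu : Finsupp.weight d u + e a = c) =>
        show Finsupp.weight d u ≤ c by omega).to_subtype
  infer_instance

/-- The coefficients of a homogeneous vector. -/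
noncomputable def homogeneousCoeffs (k : Type*) [Field k] {r : ℕ} (d : Fin m → ℕ) (e : Fin r → ℕ)
    (c : ℕ) : homogeneousVectors k d e c →ₗ[k] (VecMonomial d e c → k) :=
  LinearMap.pi (fun p => lcoeff k p.2.1 ∘ₗ LinearMap.proj p.1) ∘ₗ Submodule.subtype _

lemma homogeneousCoeffs_bijective {r : ℕ} {d : Fin m → ℕ} (hd : ∀ i, 0 < d i) (e : Fin r → ℕ)
    (c : ℕ) : Function.Bijective (homogeneousCoeffs k d e c) := by
  classical
  have := finite_vecMonomial hd e c
  have := Fintype.ofFinite (VecMonomial d e c)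
  constructor
  · rw [injective_iff_map_eq_zero]
    rintro ⟨v, hv⟩ h
    ext a u
    rw [mem_homogeneousVectors] at hv
    simp only [ZeroMemClass.coe_zero, Pi.zero_apply, coeff_zero]
    rw [← hv, coeff_vecComponent]
    split_ifs with hu
    · exact congrFun h ⟨a, u, hu⟩
    · rfl
  · intro f
    let v : Fin r → MvPolynomial (Fin m) k := ∑ p, Pi.single p.1 (monomial p.2.1 (f p))
    refine ⟨⟨vecComponent d e c v, v, rfl⟩, ?_⟩
    ext ⟨a, u, hu⟩
    change coeff u (vecComponent d e c v a) = _
    rw [coeff_vecComponent, if_pos hu]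
    simp only [v, Finset.sum_apply, coeff_sum]
    rw [Finset.sum_eq_single ⟨a, u, hu⟩]
    · simp
    · rintro ⟨b, w, hw⟩ - hne
      rcases eq_or_ne a b with rfl | hab
      · rw [Pi.single_eq_same, coeff_monomial, if_neg]
        rintro rfl
        exact hne rfl
      · simp [hab]
    · simp

lemma finite_homogeneousVectors {r : ℕ} {d : Fin m → ℕ} (hd : ∀ i, 0 < d i) (e : Fin r → ℕ)
    (c : ℕ) : Module.Finite k (homogeneousVectors k d e c) := by
  have := finite_vecMonomial hd e c
  exact Module.Finite.equiv
    (LinearEquiv.ofBijective _ (homogeneousCoeffs_bijective (k := k) hd e c)).symm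

lemma finrank_homogeneousVectors {r : ℕ} {d : Fin m → ℕ} (hd : ∀ i, 0 < d i) (e : Fin r → ℕ)
    (c : ℕ) : (Module.finrank k (homogeneousVectors k d e c) : ℤ) =
      PowerSeries.coeff c ((∑ a, (PowerSeries.X : PowerSeries ℤ) ^ e a) *
        PowerSeries.mk fun n => (monomialCount d n : ℤ)) := by
  have := finite_vecMonomial hd e c
  have := Fintype.ofFinite (VecMonomial d e c)
  have hfin : ∀ a, Finite {u : Fin m →₀ ℕ // Finsupp.weight d u + e a = c} := fun a =>
    Finite.of_injective (fun u => (⟨a, u⟩ : VecMonomial d e c)) fun u v h => by simpa using h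
  rw [(LinearEquiv.ofBijective _ (homogeneousCoeffs_bijective (k := k) hd e c)).finrank_eq,
    Module.finrank_fintype_fun_eq_card, ← Nat.card_eq_fintype_card, Nat.card_sigma, Finset.sum_mul,
    map_sum]
  push_cast
  refine Finset.sum_congr rfl fun a _ => ?_
  rw [PowerSeries.coeff_X_pow_mul', PowerSeries.coeff_mk]
  split_ifs with h
  · rw [monomialCount]
    congr 3
    ext u
    omega
  · rw [Nat.cast_eq_zero, Nat.card_eq_zero]
    exact Or.inl ⟨fun u => by have := u.2; omega⟩

/-! ### Euler characteristic of the resolution in each degree -/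

namespace MinimalGradedFreeResolution

variable {d : Fin m → ℕ} (P : MinimalGradedFreeResolution k d)

/-- The differential in degree `c`. -/
noncomputable def diffDegree (c i : ℕ) : homogeneousVectors k d (P.deg (i + 1)) c →ₗ[k]
    homogeneousVectors k d (P.deg i) c :=
  ((P.diffLin i).restrictScalars k).restrict fun v hv => by
    rw [mem_homogeneousVectors] at hv ⊢
    rw [LinearMap.restrictScalars_apply, vecComponent_diffLin, hv]

/-- The augmentation in degree `c`. -/
noncomputable def augDegree (c : ℕ) : homogeneousVectors k d (P.deg 0) c →ₗ[k] k :=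
  Polynomial.lcoeff k c ∘ₗ P.augLin ∘ₗ Submodule.subtype _

lemma diffDegree_coe {c i : ℕ} (v : homogeneousVectors k d (P.deg (i + 1)) c) :
    (P.diffDegree c i v : P.Free i) = P.diffLin i v := rfl

lemma mem_range_diffDegree {c i : ℕ} {v : homogeneousVectors k d (P.deg i) c}
    (h : ∃ w, P.diffLin i w = v) : v ∈ LinearMap.range (P.diffDegree c i) := by
  obtain ⟨w, hw⟩ := h
  refine ⟨⟨vecComponent d (P.deg (i + 1)) c w, w, rfl⟩, Subtype.ext ?_⟩
  rw [diffDegree_coe]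
  change P.diffLin i (vecComponent d (P.deg (i + 1)) c w) = _
  rw [← vecComponent_diffLin, hw]
  exact mem_homogeneousVectors.1 v.2

lemma ker_diffDegree (c i : ℕ) :
    LinearMap.ker (P.diffDegree c i) = LinearMap.range (P.diffDegree c (i + 1)) := by
  ext v
  constructor
  · intro h
    refine P.mem_range_diffDegree (P.diffLin_eq_zero_iff.1 ?_)
    exact congrArg Subtype.val (LinearMap.mem_ker.1 h)
  · rintro ⟨w, rfl⟩
    exact LinearMap.mem_ker.2 (Subtype.ext (P.diffLin_diffLin w.1))

lemma ker_augDegree (c : ℕ) :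
    LinearMap.ker (P.augDegree c) = LinearMap.range (P.diffDegree c 0) := by
  ext v
  constructor
  · intro h
    refine P.mem_range_diffDegree (P.augLin_eq_zero_iff.1 ?_)
    have h0 : (P.augLin v.1).coeff c = 0 := h
    have h1 := P.augLin_vecComponent c v.1
    rwa [h0, map_zero, mem_homogeneousVectors.1 v.2] at h1
  · rintro ⟨w, rfl⟩
    rw [LinearMap.mem_ker]
    change (P.augLin (P.diffLin 0 w.1)).coeff c = 0
    rw [augLin_diffLin, Polynomial.coeff_zero]

open Classical in
lemma finrank_range_augDegree (c : ℕ) :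
    Module.finrank k (LinearMap.range (P.augDegree c)) = if c ∈ semigroup d then 1 else 0 := by
  split_ifs with hc
  · rw [LinearMap.range_eq_top.2, finrank_top, Module.finrank_self]
    obtain ⟨u, hu⟩ := P.exists_augLin_eq (k := k) (X_pow_mem_semigroupRing hc)
    intro t
    refine ⟨t • ⟨vecComponent d (P.deg 0) c u, u, rfl⟩, ?_⟩
    rw [map_smul]
    change t • (P.augLin (vecComponent d (P.deg 0) c u)).coeff c = t
    rw [augLin_vecComponent, hu]
    simp
  · rw [show P.augDegree c = 0 from ?_, LinearMap.range_zero, finrank_bot]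
    ext v
    by_contra h
    exact hc (mem_semigroup_of_coeff_ne_zero (P.augLin_mem v.1) h)

-- Rank-nullity telescopes along the exact sequence; cutting it off at `F_N` leaves the rank of the
-- incoming differential as the error term.
open Classical in
lemma alternating_sum_finrank (hd : ∀ i, 0 < d i) (c N : ℕ) :
    ∑ i ∈ Finset.range (N + 1), (-1 : ℤ) ^ i *
        Module.finrank k (homogeneousVectors k d (P.deg i) c) =
      (if c ∈ semigroup d then 1 else 0) +
        (-1) ^ N * Module.finrank k (LinearMap.range (P.diffDegree c N)) := by
  have := fun i => finite_homogeneousVectors (k := k) hd (P.deg i) c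
  induction N with
  | zero =>
    rw [Finset.sum_range_one, ← LinearMap.finrank_range_add_finrank_ker (P.augDegree c),
      ker_augDegree, finrank_range_augDegree]
    push_cast
    ring
  | succ N ih =>
    rw [Finset.sum_range_succ, ih, ← LinearMap.finrank_range_add_finrank_ker (P.diffDegree c N),
      ker_diffDegree]
    push_cast
    ring

/-- The numerator of the Hilbert series. -/
noncomputable def hilbertNumerator : Polynomial ℤ :=
  ∑ i ∈ Finset.range m, (-1) ^ i * ∑ j, Polynomial.X ^ P.deg i j

open Classical in
lemma coe_hilbertNumerator (hm : 1 ≤ m) (hd : ∀ i, 0 < d i) :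
    (P.hilbertNumerator : PowerSeries ℤ) =
      PowerSeries.mk (fun c => if c ∈ semigroup d then (1 : ℤ) else 0) *
        ∏ i, (1 - PowerSeries.X ^ d i) := by
  have h : (P.hilbertNumerator : PowerSeries ℤ) *
      PowerSeries.mk (fun n => (monomialCount d n : ℤ)) =
      PowerSeries.mk (fun c => if c ∈ semigroup d then (1 : ℤ) else 0) := by
    obtain ⟨N, rfl⟩ : ∃ N, m = N + 1 := ⟨m - 1, by omega⟩
    have hcoe : (P.hilbertNumerator : PowerSeries ℤ) =
        ∑ i ∈ Finset.range (N + 1), (-1) ^ i * ∑ j, PowerSeries.X ^ P.deg i j := by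
      rw [← Polynomial.coeToPowerSeries.ringHom_apply, hilbertNumerator, map_sum]
      simp [map_mul, map_pow, map_sum]
    ext c
    have hs := P.alternating_sum_finrank hd c N
    -- The error term vanishes because `F_m = 0`.
    have hzero : Module.finrank k (LinearMap.range (P.diffDegree c N)) = 0 := by
      have := finite_homogeneousVectors (k := k) hd (P.deg (N + 1)) c
      have h0 : Module.finrank k (homogeneousVectors k d (P.deg (N + 1)) c) = 0 := by
        have : IsEmpty (Fin (P.rank (N + 1))) := by
          rw [P.rank_eq_zero hm le_rfl]
          infer_instance
        exact Module.finrank_zero_of_subsingleton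
      have := LinearMap.finrank_range_le (P.diffDegree c N)
      omega
    rw [hzero, Nat.cast_zero, mul_zero, add_zero] at hs
    rw [PowerSeries.coeff_mk, ← hs, hcoe, Finset.sum_mul, map_sum]
    refine Finset.sum_congr rfl fun i _ => ?_
    rw [finrank_homogeneousVectors hd, mul_assoc]
    rcases Nat.even_or_odd i with h | h
    · simp [h.neg_one_pow]
    · simp [h.neg_one_pow]
  rw [← h, mul_assoc, mul_comm (PowerSeries.mk _), prod_one_sub_mul_mk_monomialCount hd, mul_one]

end MinimalGradedFreeResolution

end Hilbert
/-! ### Generating functions of multisets of integers -/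

section GenFun

open LaurentPolynomial

/-- The Laurent polynomial `∑ T ^ a` over the elements `a` of a multiset of integers. -/
noncomputable def genFun (M : Multiset ℤ) : LaurentPolynomial ℤ :=
  (M.map T).sum

lemma genFun_add (M N : Multiset ℤ) : genFun (M + N) = genFun M + genFun N := by
  simp [genFun]

lemma genFun_sum {ι : Type*} (s : Finset ι) (M : ι → Multiset ℤ) :
    genFun (∑ i ∈ s, M i) = ∑ i ∈ s, genFun (M i) := by
  classical
  induction s using Finset.induction_on with
  | empty => simp [genFun]
  | insert i s hi ih => rw [Finset.sum_insert hi, Finset.sum_insert hi, genFun_add, ih]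

lemma genFun_finset (s : Finset ℤ) : genFun s.val = ∑ a ∈ s, T a := rfl

lemma coeff_genFun (M : Multiset ℤ) (a : ℤ) : (genFun M).coeff a = M.count a := by
  induction M using Multiset.induction_on with
  | empty => simp [genFun]
  | cons b M ih =>
    have : genFun (b ::ₘ M) = T b + genFun M := by simp [genFun]
    rw [this, AddMonoidAlgebra.coeff_add, Finsupp.add_apply, ih, Multiset.count_cons, T,
      AddMonoidAlgebra.coeff_single, Finsupp.single_apply]
    push_cast
    simp only [eq_comm (a := a)]
    ring

lemma genFun_injective : Function.Injective genFun := fun M N h => by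
  ext a
  have := congrArg (fun f => f.coeff a) h
  simpa [coeff_genFun] using this

lemma genFun_map_sub (M : Multiset ℤ) (a : ℤ) :
    genFun (M.map fun b => a - b) = T a * invert (genFun M) := by
  induction M using Multiset.induction_on with
  | empty => simp [genFun]
  | cons b M ih =>
    have h1 : ∀ (b : ℤ) M, genFun (b ::ₘ M) = T b + genFun M := by simp [genFun]
    rw [Multiset.map_cons, h1, h1, ih, map_add, invert_T, mul_add, ← T_add, sub_eq_add_neg]

lemma genFun_map_add (M : Multiset ℤ) (a : ℤ) :
    genFun (M.map fun b => b + a) = genFun M * T a := by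
  rw [genFun, genFun, Multiset.map_map, ← Multiset.sum_map_mul_right]
  exact congrArg _ (Multiset.map_congr rfl fun b _ => T_add b a)

lemma genFun_product (M N : Multiset ℤ) :
    genFun ((M ×ˢ N).map fun p => p.1 + p.2) = genFun M * genFun N := by
  induction M using Multiset.induction_on with
  | empty => simp [genFun]
  | cons b M ih =>
    have h1 : genFun (b ::ₘ M) = T b + genFun M := by simp [genFun]
    rw [Multiset.cons_product, Multiset.map_add, genFun_add, ih, h1, add_mul, Multiset.map_map]
    congr 1
    rw [mul_comm, ← genFun_map_add]
    simp [add_comm]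

lemma one_sub_T_one_ne_zero : (1 - T 1 : LaurentPolynomial ℤ) ≠ 0 := by
  intro h
  have h1 := congrArg (fun f : LaurentPolynomial ℤ => f.coeff 1) h
  simp only [← T_zero, T, AddMonoidAlgebra.coeff_sub, AddMonoidAlgebra.coeff_single] at h1
  simp at h1

end GenFun

/-! ### Gap polynomials and the functional equation -/

section Semigroup

open LaurentPolynomial

variable {m : ℕ} {d : Fin m → ℕ}

/-- The elements of `S` and their mirror images account for all integers between `0` and `F`,
up to `Δ_H`. -/
lemma IsMinimalGenerators.one_sub_T_mul (hd : IsMinimalGenerators d) (hm : 2 ≤ m) :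
    (1 - T 1) * (T (frobenius d) * invert (genFun (gaps d).val) + genFun (gaps d).val -
      genFun (gapsH d).val) = 1 - T (frobenius d) * T 1 := by
  classical
  have hF := hd.frobenius_pos hm
  set F := frobenius d with hFdef
  have hle : ∀ g ∈ gaps d, g ≤ F := fun g hg => (Finset.mem_Icc.1 (Finset.mem_filter.1 hg).1).2
  have himage : genFun ((gaps d).image fun g => F - g).val =
      T F * invert (genFun (gaps d).val) := by
    rw [← genFun_map_sub, Finset.image_val_of_injOn fun a _ b _ h => by simpa using h]
  -- For `s ∈ S` in the interval, `F - s ∉ S` because `F ∉ S`; so every `s` is a gap or the mirror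
  -- image of one.
  have hunion : (gaps d).image (fun g => F - g) ∪ gaps d = Finset.Icc 0 F := by
    ext s
    simp only [Finset.mem_union, Finset.mem_image, Finset.mem_Icc]
    constructor
    · rintro (⟨g, hg, rfl⟩ | hg)
      · have := hle g hg
        have := (hd.mem_gaps.1 hg).1
        omega
      · have := hle s hg
        have := (hd.mem_gaps.1 hg).1
        omega
    · rintro ⟨h0, h1⟩
      by_cases hs : s ∈ gaps d
      · exact Or.inr hs
      refine Or.inl ⟨F - s, hd.mem_gaps.2 ?_, by ring⟩
      have hsS : s ∈ semigroupInt d := by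
        by_contra hsS
        refine hs (hd.mem_gaps.2 ⟨lt_of_le_of_ne h0 ?_, hsS⟩)
        rintro rfl
        exact hsS zero_mem_semigroupInt
      have hFs : F - s ∉ semigroupInt d := fun h => hd.frobenius_notMem (by
        have := add_mem_semigroupInt h hsS
        rwa [sub_add_cancel] at this)
      refine ⟨?_, hFs⟩
      have : F - s ≠ 0 := fun h => hFs (h ▸ zero_mem_semigroupInt)
      omega
  have hinter : (gaps d).image (fun g => F - g) ∩ gaps d = gapsH d := by
    ext h
    rw [Finset.mem_inter, mem_gapsH, ← hFdef, and_comm]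
    refine and_congr_right fun hh => ?_
    rw [Finset.mem_image]
    constructor
    · rintro ⟨g, hg, rfl⟩
      rw [sub_sub_cancel]
      exact (hd.mem_gaps.1 hg).2
    · exact fun h1 => ⟨F - h, (mem_gapsH.1 (hd.sub_mem_gapsH (mem_gapsH.2 ⟨hh, h1⟩))).1, by ring⟩
  have hsum := Finset.sum_union_inter (s₁ := (gaps d).image fun g => F - g) (s₂ := gaps d)
    (f := fun a => (T a : LaurentPolynomial ℤ))
  rw [hunion, hinter, ← genFun_finset, ← genFun_finset (gapsH d), ← genFun_finset (Finset.image _ _),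
    ← genFun_finset (gaps d), himage] at hsum
  rw [← hsum, add_sub_cancel_right, genFun_finset]
  obtain ⟨N, hN⟩ : ∃ N : ℕ, F = N := ⟨F.toNat, by omega⟩
  rw [hN]
  have hgeom : ∑ a ∈ Finset.Icc (0 : ℤ) N, (T a : LaurentPolynomial ℤ) =
      ∑ i ∈ Finset.range (N + 1), T 1 ^ i := by
    refine (Finset.sum_bij (fun (i : ℕ) _ => (i : ℤ)) (fun i hi => ?_) (fun i _ j _ h => by
      simpa using h) (fun a ha => ?_) (fun i _ => by rw [T_pow, mul_one])).symm
    · rw [Finset.mem_range] at hi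
      rw [Finset.mem_Icc]
      omega
    · rw [Finset.mem_Icc] at ha
      exact ⟨a.toNat, by rw [Finset.mem_range]; omega, by omega⟩
  rw [hgeom, mul_neg_geom_sum, T_pow, ← T_add]
  push_cast
  ring_nf

lemma IsMinimalGenerators.T_mul_invert_gapsH (hd : IsMinimalGenerators d) :
    T (frobenius d) * invert (genFun (gapsH d).val) = genFun (gapsH d).val := by
  rw [← genFun_map_sub, genFun, genFun_finset, Multiset.map_map]
  exact Finset.sum_bij (fun h _ => frobenius d - h) (fun h hh => hd.sub_mem_gapsH hh)
    (fun a _ b _ h => by simpa using h)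
    (fun h hh => ⟨_, hd.sub_mem_gapsH hh, by ring⟩) (fun _ _ => rfl)

lemma genFun_genGapSums (i : ℕ) :
    genFun (genGapSums d i) = genFun (genSums d i) * genFun (gapsH d).val :=
  genFun_product _ _

lemma genFun_genSums (i : ℕ) :
    genFun (genSums d i) = ∑ I ∈ Finset.univ.powersetCard i, T (∑ j ∈ I, (d j : ℤ)) := by
  rw [genFun, genSums, Multiset.map_map]
  rfl

lemma prod_T (I : Finset (Fin m)) :
    ∏ j ∈ I, (T (d j) : LaurentPolynomial ℤ) = T (∑ j ∈ I, (d j : ℤ)) := by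
  classical
  induction I using Finset.induction_on with
  | empty => simp
  | insert i s hi ih => rw [Finset.prod_insert hi, Finset.sum_insert hi, T_add, ih]

lemma prod_one_sub_T : ∏ i, (1 - T (d i) : LaurentPolynomial ℤ) =
    ∑ i ∈ Finset.range (m + 1), (-1) ^ i * genFun (genSums d i) := by
  classical
  have h := Finset.prod_add (fun i => -(T (d i) : LaurentPolynomial ℤ)) (fun _ => 1) Finset.univ
  simp only [Finset.prod_const_one, mul_one, Finset.prod_neg, prod_T, neg_add_eq_sub] at h
  rw [h, Finset.sum_powerset, Finset.card_univ, Fintype.card_fin]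
  refine Finset.sum_congr rfl fun i _ => ?_
  rw [genFun_genSums, Finset.mul_sum]
  exact Finset.sum_congr rfl fun I hI => by rw [(Finset.mem_powersetCard.1 hI).2]

lemma prod_one_sub_T_eq (hm : 1 ≤ m) : ∏ i, (1 - T (d i) : LaurentPolynomial ℤ) =
    1 + (∑ i ∈ Finset.Icc 1 (m - 1), (-1) ^ i * genFun (genSums d i)) +
      (-1) ^ m * T (genSum d) := by
  obtain ⟨N, rfl⟩ : ∃ N, m = N + 1 := ⟨m - 1, by omega⟩
  rw [prod_one_sub_T, Finset.sum_range_succ, Finset.sum_range_succ', add_tsub_cancel_right,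
    Finset.range_eq_Ico, Finset.sum_Ico_add' (fun i => (-1) ^ i * genFun (genSums d i)) 0 N 1]
  have h0 : genFun (genSums d 0) = 1 := by simp [genFun_genSums]
  have h1 : genFun (genSums d (N + 1)) = T (genSum d) := by
    have : (Finset.univ : Finset (Fin (N + 1))).powersetCard (N + 1) = {Finset.univ} := by
      have := Finset.powersetCard_self (Finset.univ : Finset (Fin (N + 1)))
      rwa [Finset.card_univ, Fintype.card_fin] at this
    rw [genFun_genSums, this, Finset.sum_singleton, genSum]
  rw [h0, h1, pow_zero, mul_one, add_comm (Finset.sum _ _) 1]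
  rfl

/-- Each factor satisfies `T^{d_i} (1 - T^{-d_i}) = -(1 - T^{d_i})`, and the number of signs is odd.
-/
lemma T_mul_invert_prod (hm : Odd m) :
    T (genSum d) * invert (∏ i, (1 - T (d i)) : LaurentPolynomial ℤ) =
      -∏ i, (1 - T (d i) : LaurentPolynomial ℤ) := by
  rw [genSum, ← prod_T, map_prod, ← Finset.prod_mul_distrib]
  have : ∀ i, (T (d i) : LaurentPolynomial ℤ) * invert (1 - T (d i)) = -(1 - T (d i)) := by
    intro i
    rw [map_sub, map_one, invert_T, mul_sub, ← T_add, add_neg_cancel, T_zero]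
    ring
  simp only [this, Finset.prod_neg, Finset.card_univ, Fintype.card_fin, hm.neg_one_pow]
  ring

variable {k : Type*} [Field k]

namespace MinimalGradedFreeResolution

/-- The generating function of `S` is `1/(1 - X)` minus the gap polynomial; the factor `1 - X`
clears the denominator. -/
lemma one_sub_X_mul_hilbertNumerator (P : MinimalGradedFreeResolution k d) (hm : 1 ≤ m)
    (hd : IsMinimalGenerators d) :
    (1 - Polynomial.X) * P.hilbertNumerator =
      (1 - (1 - Polynomial.X) * ∑ g ∈ gaps d, Polynomial.X ^ g.toNat) *
        ∏ i, (1 - Polynomial.X ^ d i) := by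
  classical
  refine Polynomial.coe_injective ℤ ?_
  have hG : PowerSeries.mk (fun c => if c ∈ semigroup d then (1 : ℤ) else 0) =
      PowerSeries.mk 1 - ((∑ g ∈ gaps d, Polynomial.X ^ g.toNat : Polynomial ℤ) :
        PowerSeries ℤ) := by
    ext c
    rw [map_sub, Polynomial.coeff_coe, PowerSeries.coeff_mk, PowerSeries.coeff_mk,
      Polynomial.finsetSum_coeff]
    have : ∀ g ∈ gaps d, (Polynomial.X ^ g.toNat : Polynomial ℤ).coeff c =
        if (c : ℤ) = g then 1 else 0 := by
      intro g hg
      have := (hd.mem_gaps.1 hg).1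
      rw [Polynomial.coeff_X_pow]
      congr 1
      exact propext (by omega)
    rw [Finset.sum_congr rfl this, Finset.sum_ite_eq]
    simp only [hd.mem_gaps, natCast_mem_semigroupInt]
    by_cases hc : c ∈ semigroup d
    · simp [hc]
    · have : 0 < c := Nat.pos_of_ne_zero fun h => hc (h ▸ zero_mem _)
      simp [hc, this]
  have hprod : ((∏ i, (1 - Polynomial.X ^ d i) : Polynomial ℤ) : PowerSeries ℤ) =
      ∏ i, (1 - PowerSeries.X ^ d i) := by
    rw [← Polynomial.coeToPowerSeries.ringHom_apply, map_prod]
    simp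
  rw [Polynomial.coe_mul, Polynomial.coe_mul, P.coe_hilbertNumerator hm hd.pos, hG, hprod,
    Polynomial.coe_sub, Polynomial.coe_sub, Polynomial.coe_mul, Polynomial.coe_sub,
    Polynomial.coe_one, Polynomial.coe_X]
  linear_combination (∏ i, (1 - PowerSeries.X ^ d i)) *
    PowerSeries.mk_one_mul_one_sub_eq_one ℤ

/-- The numerator of the Hilbert series vanishes at `1`. -/
lemma eval_one_hilbertNumerator (P : MinimalGradedFreeResolution k d) (hm : 2 ≤ m)
    (hd : IsMinimalGenerators d) : P.hilbertNumerator.eval 1 = 0 := by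
  have h := P.one_sub_X_mul_hilbertNumerator (by omega) hd
  -- The product vanishes to order at least `m ≥ 2` at `1`, and the factor `1 - X` in front of the
  -- numerator accounts for only one order.
  have h1 : (1 - Polynomial.X : Polynomial ℤ) ^ m ∣ ∏ i, (1 - Polynomial.X ^ d i) := by
    have := Finset.prod_dvd_prod_of_dvd (s := Finset.univ) (fun _ : Fin m =>
      (1 - Polynomial.X : Polynomial ℤ)) (fun i => 1 - Polynomial.X ^ d i)
      fun i _ => by simpa using sub_dvd_pow_sub_pow (1 : Polynomial ℤ) Polynomial.X (d i)
    simpa using this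
  have h2 := ((pow_dvd_pow _ hm).trans h1).trans (Dvd.intro_left _ h.symm)
  have h0 : (1 - Polynomial.X : Polynomial ℤ) ≠ 0 := fun h0 => by
    simpa using congrArg (Polynomial.eval 0) h0
  rw [pow_two, mul_dvd_mul_iff_left h0] at h2
  obtain ⟨q, hq⟩ := h2
  rw [hq]
  simp

lemma toLaurent_hilbertNumerator (P : MinimalGradedFreeResolution k d) :
    Polynomial.toLaurent P.hilbertNumerator =
      ∑ i ∈ Finset.range m, (-1) ^ i * genFun (P.syzygyDegrees i) := by
  rw [hilbertNumerator, map_sum]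
  refine Finset.sum_congr rfl fun i _ => ?_
  rw [map_mul, map_pow, map_neg, map_one, map_sum, genFun, syzygyDegrees, Multiset.map_map]
  congr 1
  exact Finset.sum_congr rfl fun j _ => Polynomial.toLaurent_X_pow _

/-- The functional equation of the numerator of the Hilbert series. -/
lemma functional_equation (P : MinimalGradedFreeResolution k d) (hm : 2 ≤ m) (hodd : Odd m)
    (hd : IsMinimalGenerators d) :
    T (frobenius d + genSum d) * invert (Polynomial.toLaurent P.hilbertNumerator) =
      Polynomial.toLaurent P.hilbertNumerator +
        (∏ i, (1 - T (d i))) * genFun (gapsH d).val := by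
  have hA := congrArg Polynomial.toLaurent (P.one_sub_X_mul_hilbertNumerator (by omega) hd)
  have hG : Polynomial.toLaurent (∑ g ∈ gaps d, Polynomial.X ^ g.toNat : Polynomial ℤ) =
      genFun (gaps d).val := by
    rw [map_sum, genFun_finset]
    refine Finset.sum_congr rfl fun g hg => ?_
    rw [Polynomial.toLaurent_X_pow, Int.toNat_of_nonneg (hd.mem_gaps.1 hg).1.le]
  simp only [map_mul, map_sub, map_one, map_prod, map_pow, hG, Polynomial.toLaurent_X, T_pow,
    mul_one] at hA
  have hB := hd.one_sub_T_mul hm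
  have hD := T_mul_invert_prod (d := d) hodd
  have hA' := congrArg invert hA
  rw [map_mul, map_mul, map_sub, map_sub, map_mul, map_sub, map_one, invert_T] at hA'
  have hT : (T 1 * T (-1) : LaurentPolynomial ℤ) = 1 := by rw [← T_add, add_neg_cancel, T_zero]
  refine mul_left_cancel₀ one_sub_T_one_ne_zero ?_
  rw [T_add]
  -- What remains is an identity in a commutative ring: primes mark the images under `T ↦ T⁻¹`, and
  -- `a * b = 1` is the only relation needed besides `hA`, `hA'`, `hB`, `hD`.
  generalize invert (Polynomial.toLaurent P.hilbertNumerator) = Q' at *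
  generalize Polynomial.toLaurent P.hilbertNumerator = Q at *
  generalize invert (∏ i, (1 - T (d i)) : LaurentPolynomial ℤ) = D' at *
  generalize (∏ i, (1 - T (d i)) : LaurentPolynomial ℤ) = D at *
  generalize invert (genFun (gaps d).val) = G' at *
  generalize genFun (gaps d).val = G at *
  generalize genFun (gapsH d).val = H at *
  generalize (T (frobenius d) : LaurentPolynomial ℤ) = f at *
  generalize (T (genSum d) : LaurentPolynomial ℤ) = s at *
  generalize (T (-1) : LaurentPolynomial ℤ) = b at *
  generalize (T 1 : LaurentPolynomial ℤ) = a at *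
  linear_combination (-a * f * s) * hA' + (-a * f * (1 - (1 - b) * G')) * hD - hA + D * hB +
    (-f * s * Q' + f * D * G') * hT

end MinimalGradedFreeResolution

end Semigroup
/-! ### The join identity of the multisets of degrees -/

lemma sum_Icc_neg_one_pow_mul {R : Type*} [CommRing R] (f : ℕ → R) (N : ℕ) :
    ∑ i ∈ Finset.Icc 1 N, (-1) ^ i * f i =
      (∑ i ∈ Finset.Icc 1 N with Even i, f i) - ∑ i ∈ Finset.Icc 1 N with Odd i, f i := by
  rw [Finset.sum_filter, Finset.sum_filter, ← Finset.sum_sub_distrib]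
  refine Finset.sum_congr rfl fun i _ => ?_
  rcases Nat.even_or_odd i with h | h
  · simp [h, h.neg_one_pow, Nat.not_odd_iff_even.2 h]
  · simp [h, h.neg_one_pow, Nat.not_even_iff_odd.2 h]

lemma alternating_sum_range {R : Type*} [CommRing R] (f : ℕ → R) {n : ℕ} (hn : 1 ≤ n) :
    ∑ i ∈ Finset.range (2 * n + 1), (-1) ^ i * f i =
      f 0 + f (2 * n) + (∑ q ∈ Finset.Icc 1 (n - 1), f (2 * q)) -
        ∑ q ∈ Finset.Icc 1 n, f (2 * q - 1) := by
  induction n, hn using Nat.le_induction with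
  | base => simp [Finset.sum_range_succ]; ring
  | succ n hn ih =>
    rw [show 2 * (n + 1) + 1 = 2 * n + 1 + 1 + 1 by ring, Finset.sum_range_succ,
      Finset.sum_range_succ, ih, Finset.sum_Icc_succ_top (by omega), add_tsub_cancel_right]
    obtain ⟨t, rfl⟩ : ∃ t, n = t + 1 := ⟨n - 1, by omega⟩
    rw [Finset.sum_Icc_succ_top (by omega : 1 ≤ t + 1),
      Finset.sum_Icc_succ_top (by omega : 1 ≤ t + 1), add_tsub_cancel_right,
      show 2 * (t + 1 + 1) - 1 = 2 * (t + 1) + 1 by omega]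
    have h1 : (-1 : R) ^ (2 * (t + 1) + 1) = -1 := Odd.neg_one_pow ⟨_, rfl⟩
    have h2 : (-1 : R) ^ (2 * (t + 1) + 1 + 1) = 1 := Even.neg_one_pow ⟨t + 2, by ring⟩
    rw [h1, h2, show 2 * (t + 1) + 1 + 1 = 2 * (t + 1 + 1) by ring]
    ring

section Join

open LaurentPolynomial

variable {k : Type*} [Field k] {n : ℕ} {d : Fin (2 * n + 1) → ℕ}

namespace MinimalGradedFreeResolution

variable {m : ℕ} {e : Fin m → ℕ}

lemma rank_zero (P : MinimalGradedFreeResolution k e) : P.rank 0 = 1 := by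
  obtain ⟨b, hb, -⟩ := P.exists_unique_generator
  exact (Fintype.card_fin _).symm.trans (Fintype.card_eq_one_iff.2 ⟨b, hb⟩)

lemma syzygyDegrees_zero (P : MinimalGradedFreeResolution k e) : P.syzygyDegrees 0 = {0} := by
  obtain ⟨b, hb, hdeg, -⟩ := P.exists_unique_generator
  have : (Finset.univ : Finset (Fin (P.rank 0))) = {b} := by
    ext j
    simp [hb j]
  simp [syzygyDegrees, this, hdeg]

lemma card_syzygyDegrees (P : MinimalGradedFreeResolution k e) (i : ℕ) :
    (P.syzygyDegrees i).card = P.betti i := by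
  simp [syzygyDegrees, betti]

lemma card_dualDegrees (P : MinimalGradedFreeResolution k e) (i : ℕ) :
    (P.dualDegrees i).card = P.betti i := by
  simp [dualDegrees, card_syzygyDegrees]

lemma betti_last (P : MinimalGradedFreeResolution k e) (hd : IsMinimalGenerators e)
    (hS : IsAlmostSymmetric e) {r : ℕ} (hr : r + 1 = m) : P.betti r = gam e + 1 := by
  rw [← card_syzygyDegrees, syzygyDegrees_last hd hS P hr, Multiset.card_map, Finset.card_val,
    Finset.card_insert_of_notMem frobenius_notMem_gapsH, gam]

lemma degreesOne_add_genGapSumsOdd (P : MinimalGradedFreeResolution k d) (hn : 1 ≤ n)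
    (hd : IsMinimalGenerators d) (hS : IsAlmostSymmetric d) :
    P.degreesOne + genGapSumsOdd d = P.degreesTwo + genGapSumsEven d := by
  refine genFun_injective ?_
  have hF := P.functional_equation (by omega) ⟨n, rfl⟩ hd
  have hQ := alternating_sum_range (fun i => genFun (P.syzygyDegrees i)) hn
  rw [← toLaurent_hilbertNumerator] at hQ
  have hdual : ∀ i, genFun (P.dualDegrees i) =
      T (frobenius d + genSum d) * invert (genFun (P.syzygyDegrees i)) :=
    fun i => genFun_map_sub _ _
  have h0 : genFun (P.syzygyDegrees 0) = 1 := by simp [syzygyDegrees_zero, genFun]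
  have hlast : genFun (P.syzygyDegrees (2 * n)) =
      (T (frobenius d) + genFun (gapsH d).val) * T (genSum d) := by
    rw [syzygyDegrees_last hd hS P rfl, genFun_map_add, genFun_finset,
      Finset.sum_insert frobenius_notMem_gapsH, genFun_finset]
  have hprod := prod_one_sub_T_eq (d := d) (by omega)
  rw [sum_Icc_neg_one_pow_mul, Odd.neg_one_pow ⟨n, rfl⟩] at hprod
  have hQ' := congrArg (fun f => T (frobenius d + genSum d) * invert f) hQ
  simp only [h0, hlast, map_sub, map_add, map_mul, map_one, map_sum, invert_T, mul_sub, mul_add,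
    Finset.mul_sum, ← hdual] at hQ'
  rw [hF, hQ, h0, hlast, hprod] at hQ'
  have hT : (T (genSum d) * T (-genSum d) : LaurentPolynomial ℤ) = 1 := by
    rw [← T_add, add_neg_cancel, T_zero]
  have hT' : (T (frobenius d) * T (-frobenius d) : LaurentPolynomial ℤ) = 1 := by
    rw [← T_add, add_neg_cancel, T_zero]
  have hH := hd.T_mul_invert_gapsH
  simp only [degreesOne, degreesTwo, genGapSumsOdd, genGapSumsEven, genFun_add, genFun_sum,
    genFun_genGapSums, ← Finset.sum_mul]
  rw [T_add] at hQ'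
  -- Duality sends the last degrees `F + Σ` and `h + Σ` to `0` and `F - h`, and `h ↦ F - h` permutes
  -- `Δ_H`. The terms `1`, `T^{F+Σ}` and `H` thus occur on both sides, while `H T^Σ` from `F_{2n}`
  -- cancels the top term of `D H`, negative as `m` is odd.
  linear_combination -hQ' - hH - (T (frobenius d) * T (-frobenius d) +
    T (frobenius d) * invert (genFun (gapsH d).val)) * hT - hT'

end MinimalGradedFreeResolution

lemma card_genGapSums (i : ℕ) : (genGapSums d i).card = (2 * n + 1).choose i * gam d := by
  simp [genGapSums, genSums, gam]

/-- The multisets `L_o` and `L_e` have together `γ (2 ^ (2n+1) - 2)` elements. -/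
lemma card_genGapSumsOdd_add_card_genGapSumsEven :
    (genGapSumsOdd d).card + (genGapSumsEven d).card + 2 * gam d = gam d * 2 ^ (2 * n + 1) := by
  have h := Nat.sum_range_choose (2 * n + 1)
  rw [Finset.sum_range_succ, Finset.sum_range_succ', Nat.choose_self, Nat.choose_zero_right,
    Finset.range_eq_Ico, Finset.sum_Ico_add' (fun i => (2 * n + 1).choose i) 0 (2 * n) 1] at h
  have h1 : (genGapSumsOdd d).card + (genGapSumsEven d).card =
      (∑ i ∈ Finset.Ico (0 + 1) (2 * n + 1), (2 * n + 1).choose i) * gam d := by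
    simp only [genGapSumsOdd, genGapSumsEven, Multiset.card_sum, card_genGapSums,
      ← Finset.sum_mul, ← add_mul, ← Nat.not_odd_iff_even]
    rw [Finset.sum_filter_add_sum_filter_not]
    rfl
  rw [h1, ← h]
  ring

end Join

/-! ### Counting the two joins -/

namespace MinimalGradedFreeResolution

/-- The sums of the Betti numbers over the odd and over the even homological degrees. -/
theorem sum_betti_odd_and_sum_betti_even {k : Type*} [Field k]
    (n : ℕ) (hn : 1 ≤ n)
    (d : Fin (2 * n + 1) → ℕ) (hd : IsMinimalGenerators d)
    (hS : IsAlmostSymmetric d)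
    (P : MinimalGradedFreeResolution k d) :
    (∑ q ∈ Finset.Icc 1 n, (P.betti (2 * q - 1) : ℚ)) =
        (gam d : ℚ) * 2 ^ (2 * n - 1) + (P.delta : ℚ) / 2 + 1 ∧
      (∑ q ∈ Finset.Icc 1 (n - 1), (P.betti (2 * q) : ℚ)) =
        (gam d : ℚ) * (2 ^ (2 * n - 1) - 1) + (P.delta : ℚ) / 2 - 1 := by
  have hjoin := P.degreesOne_add_genGapSumsOdd hn hd hS
  have hcard1 : P.degreesOne.card = (∑ q ∈ Finset.Icc 1 n, P.betti (2 * q - 1)) +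
      ∑ q ∈ Finset.Icc 1 (n - 1), P.betti (2 * q) := by
    simp [degreesOne, card_syzygyDegrees, card_dualDegrees]
  have hcard2 : P.degreesTwo.card = P.degreesOne.card := by
    rw [hcard1, add_comm]
    simp [degreesTwo, card_syzygyDegrees, card_dualDegrees]
  have hcards := congrArg Multiset.card hjoin
  rw [Multiset.card_add, Multiset.card_add, hcard2] at hcards
  -- At each integer the multiplicities satisfy `x₁ + l_o = x₂ + l_e`, so the truncated differences
  -- `x₁ - x₂` and `l_e - l_o` agree.
  have hdiff : P.degreesOne - P.degreesTwo = genGapSumsEven d - genGapSumsOdd d := by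
    ext a
    have := congrArg (Multiset.count a) hjoin
    rw [Multiset.count_add, Multiset.count_add] at this
    rw [Multiset.count_sub, Multiset.count_sub]
    omega
  have hsub : ∀ A B : Multiset ℤ, (A - B).card + (A ∩ B).card = A.card := fun A B => by
    rw [← Multiset.card_add, Multiset.sub_add_inter]
  have hX := hsub P.degreesOne P.degreesTwo
  have hL := hsub (genGapSumsEven d) (genGapSumsOdd d)
  rw [hdiff] at hX
  have hLL := card_genGapSumsOdd_add_card_genGapSumsEven (d := d)
  -- The Euler characteristic of the ranks; with `β_0 = 1` and `β_{2n} = γ + 1` it reads `o - e = γ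
  -- + 2`.
  have heval : (∑ i ∈ Finset.range (2 * n + 1), (-1 : ℤ) ^ i * P.betti i) = 0 := by
    have := P.eval_one_hilbertNumerator (by omega) hd
    simpa [hilbertNumerator, Polynomial.eval_finsetSum, betti] using this
  rw [alternating_sum_range (fun i => (P.betti i : ℤ)) hn, P.betti_last hd hS rfl, betti,
    P.rank_zero] at heval
  set o := ∑ q ∈ Finset.Icc 1 n, P.betti (2 * q - 1) with ho
  set e := ∑ q ∈ Finset.Icc 1 (n - 1), P.betti (2 * q) with he
  have hoQ : (∑ q ∈ Finset.Icc 1 n, (P.betti (2 * q - 1) : ℚ)) = o := by rw [ho]; push_cast; rfl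
  have heQ : (∑ q ∈ Finset.Icc 1 (n - 1), (P.betti (2 * q) : ℚ)) = e := by rw [he]; push_cast; rfl
  have hdelta : P.delta = (P.degreesOne ∩ P.degreesTwo).card -
      (genGapSumsEven d ∩ genGapSumsOdd d).card := rfl
  rw [hoQ, heQ, hdelta]
  obtain ⟨t, rfl⟩ : ∃ t, n = t + 1 := ⟨n - 1, by omega⟩
  have hpow : 2 ^ (2 * (t + 1) + 1) = 4 * 2 ^ (2 * t + 1) := by ring
  rw [hpow] at hLL
  rw [show 2 * (t + 1) - 1 = 2 * t + 1 by omega]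
  have heval' : (1 : ℚ) + (gam d + 1) + e - o = 0 := by
    rw [ho, he]
    exact_mod_cast heval
  rw [hcard1] at hX
  have hXQ := congrArg (Nat.cast (R := ℚ)) hX
  have hLQ := congrArg (Nat.cast (R := ℚ)) hL
  have hLLQ := congrArg (Nat.cast (R := ℚ)) hLL
  have hcQ := congrArg (Nat.cast (R := ℚ)) hcards
  push_cast at hXQ hLQ hLLQ hcQ ⊢
  -- `hcQ` and `hLLQ` give `#𝔏_e = γ (2^{2n} - 1)`, then `hXQ` and `hLQ` give `o + e = #𝔏_e + δ`;
  -- with `heval'` this determines `o` and `e`.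
  constructor <;> linarith

end MinimalGradedFreeResolution

end NumSemigroup

theorem theorem6 {k : Type*} [Field k] [CharZero k] (n : ℕ) (hn : 1 ≤ n)
    (d : Fin (2 * n + 1) → ℕ) (hd : NumSemigroup.IsMinimalGenerators d)
    (hS : NumSemigroup.IsAlmostSymmetric d)
    (P : NumSemigroup.MinimalGradedFreeResolution k d) :
    (∑ q ∈ Finset.Icc 1 n, (P.betti (2 * q - 1) : ℚ)) =
        (NumSemigroup.gam d : ℚ) * 2 ^ (2 * n - 1) + (P.delta : ℚ) / 2 + 1 ∧
      (∑ q ∈ Finset.Icc 1 (n - 1), (P.betti (2 * q) : ℚ)) =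
        (NumSemigroup.gam d : ℚ) * (2 ^ (2 * n - 1) - 1) + (P.delta : ℚ) / 2 - 1 :=
  NumSemigroup.MinimalGradedFreeResolution.sum_betti_odd_and_sum_betti_even n hn d hd hS P
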